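/- Lemma 3 (preamble detection probability at a randomly chosen BS). Model. Consider a slotted uplink network with BSs and devices in $\mathbb R^2$, BS intensity $\lambda_B>0$, device intensity $\lambda_D>0$, $\xi\ge 1$ preambles chosen equiprobably, and let $\lambda_{Dp}=\lambda_D/\xi$ be the intensity of the devices using one given preamble. The path-loss exponent is $\alpha>2$, the received power under full path-loss inversion is $\rho>0$, the noise power is $\sigma^2\ge 0$, the SINR threshold is $\gamma_{\rm th}>0$, and $c=3.575$. In slot $m$ a device is active if its buffer is non-empty, $N^m_{\rm New}+N^m_{\rm Cum}>0$, and its access attempt is not restricted; $\mathcal T^m=\mathbb P\{N^m_{\rm New}+N^m_{\rm Cum}>0\}$ and $\mathcal R^m=\mathbb P\{\text{unrestricted}\}$, both assumed positive. A randomly chosen (typical) BS is placed at the origin. The modelling assumptions in slot $m$ are as follows. * The number $|\widehat Z_{in}|$ of active devices in the typical cell that use the tagged preamble has the approximate Poisson-Voronoi law, with $x_m=\mathcal T^m\mathcal R^m\lambda_{Dp}/\lambda_B$, $$\mathbb P\{|\widehat Z_{in}|=n\}=\frac{c^c\,\Gamma(n+c)\,x_m^{\,n}}{\Gamma(c)\,\Gamma(n+1)\,(x_m+c)^{n+c}},\qquad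 n\ge 0 .$$ If the cell is non-empty, one of these devices is tagged; the other $Z_B=|\widehat Z_{in}|-1$ interfere, and $\mathcal I_{\rm intra}=\sum_{j=1}^{Z_B}\rho h_j$. * The devices using the tagged preamble form a homogeneous Poisson point process $\{u_i\}$ of intensity $\lambda_{Dp}$. Device $i$ has a distance $r_i$ to its closest BS other than the typical one, distributed as the distance from a fixed location to the closest point of a homogeneous Poisson point process of intensity $\lambda_B$; it transmits with power $P_i=\rho r_i^\alpha$ and belongs to another cell iff $r_i<\|u_i\|$. Thus $\mathcal I_{\rm inter}=\sum_{i} \mathbf 1\{r_i<\|u_i\|\}\,\mathbf 1\{i\text{ active}\}\,P_i\,h_i'\,\|u_i\|^{-\alpha}$. * The distances $r_i$, the buffer states, and the unrestricted indicators are each identically distributed over the devices, and all channel gains $h_0,h_j,h'_i$ are exponential with unit mean. The point process $\{u_i\}$, all $r_i$, all buffer states, all unrestricted indicators, all channel gains, and $|\widehat Z_{in}|$ are mutually independent. Let $\mathcal P^m_{detection}=\mathbb P\Big\{\dfrac{\rho h_0}{\mathcal I_{\rm intra}+\mathcal I_{\rm inter}+\sigma^2}\ge\gamma_{\rm th}\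 \Big|\ |\widehat Z_{in}|\ge 1\Big\}$, where $h_0$ is the gain of the tagged device. Claim. The integral below converges, and $$\mathcal P^m_{detection}=\exp\Big(-\frac{\gamma_{\rm th}\sigma^2}{\rho}-2\gamma_{\rm th}^{2/\alpha}\frac{\mathcal T^m\mathcal R^m\lambda_{Dp}}{\lambda_B}\int_{\gamma_{\rm th}^{-1/\alpha}}^\infty\frac{y}{1+y^\alpha}\,dy\Big)\Big[\Big(1+\frac{\mathcal T^m\mathcal R^m\lambda_{Dp}\gamma_{\rm th}}{c\lambda_B(1+\gamma_{\rm th})}\Big)^{-c}-\Big(\frac{c\lambda_B}{c\lambda_B+\mathcal T^m\mathcal R^m\lambda_{Dp}}\Big)^{c}\Big]\frac{(1+\gamma_{\rm th})\Big(1+\frac{\mathcal T^m\mathcal R^m\lambda_{Dp}}{c\lambda_B}\Big)^c}{\Big(1+\frac{\mathcal T^m\mathcal R^m\lambda_{Dp}}{c\lambda_B}\Big)^c-1}.$$ -/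

import Mathlib

open MeasureTheory ProbabilityTheory
open scoped ENNReal

/-- The Euclidean plane. -/
abbrev Plane : Type := EuclideanSpace ℝ (Fin 2)

/-- The number of points of the sequence `X` that lie in `A`. -/
noncomputable def pointCount {Ω : Type*} (X : ℕ → Ω → Plane) (A : Set Plane) (ω : Ω) : ℕ∞ :=
  {i : ℕ | X i ω ∈ A}.encard

/-- `X` enumerates a homogeneous Poisson point process of intensity `lam` on the plane: the number
of points in a set of finite area is Poisson distributed, with mean `lam` times the area, and the
numbers of points in pairwise disjoint sets are independent. -/
structure IsHomogeneousPPP {Ω : Type*} [MeasurableSpace Ω] (μ : Measure Ω)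
    (X : ℕ → Ω → Plane) (lam : ℝ) : Prop where
  measurable : ∀ i, Measurable (X i)
  count_law : ∀ A : Set Plane, MeasurableSet A → volume A ≠ ∞ → ∀ k : ℕ,
    μ {ω | pointCount X A ω = k} =
      ENNReal.ofReal (Real.exp (-(lam * (volume A).toReal)) *
        (lam * (volume A).toReal) ^ k / (k.factorial : ℝ))
  indep : ∀ (n : ℕ) (A : Fin n → Set Plane), (∀ j, MeasurableSet (A j)) →
    Pairwise (fun j k => Disjoint (A j) (A k)) →
    iIndepFun (fun j ω => pointCount X (A j) ω) μ

/-- The constant `c = 3.575` of the approximate size distribution of Poisson-Voronoi cells. -/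
noncomputable def cellConst : ℝ := 3.575

/-- The probability that a randomly chosen cell holds exactly `n` active devices, where `x` is the
mean number of active devices per cell. -/
noncomputable def cellCountPMF (x : ℝ) (n : ℕ) : ℝ :=
  cellConst ^ cellConst * Real.Gamma (n + cellConst) * x ^ n /
    (Real.Gamma cellConst * Real.Gamma (n + 1) * (x + cellConst) ^ ((n : ℝ) + cellConst))

/-- The deterministic parameters of the network. -/
structure RachParams where
  /-- intensity of the base stations -/
  lamB : ℝ
  /-- intensity of the devices -/
  lamD : ℝ
  /-- number of preambles -/
  ξ : ℕ
  /-- received power under full path-loss inversion -/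
  ρ : ℝ
  /-- path-loss exponent -/
  α : ℝ
  /-- noise power `σ²` -/
  noise : ℝ
  /-- SINR threshold -/
  γ : ℝ
  lamB_pos : 0 < lamB
  lamD_pos : 0 < lamD
  ξ_pos : 0 < ξ
  ρ_pos : 0 < ρ
  two_lt_α : 2 < α
  noise_nonneg : 0 ≤ noise
  γ_pos : 0 < γ

/-- Intensity of the devices that use one given preamble. -/
noncomputable def RachParams.lamDp (p : RachParams) : ℝ := p.lamD / p.ξ

/-- The random elements of the network, seen from a randomly chosen (typical) base station at the
origin. The index `m` is the time slot. Only devices that use the tagged preamble are listed. -/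
structure RachElements (Ω : Type*) where
  /-- positions of the (other) base stations -/
  bs : ℕ → Ω → Plane
  /-- positions `u i` of the devices outside the typical cell are those of these points that
  satisfy `serve i < ‖u i‖` -/
  u : ℕ → Ω → Plane
  /-- distance `r i` from device `i` to the closest base station other than the typical one -/
  serve : ℕ → Ω → ℝ
  /-- number of packets newly arrived at device `i` in slot `m` -/
  newPackets : ℕ → ℕ → Ω → ℕ
  /-- number of packets accumulated at device `i` in slot `m` -/
  cumPackets : ℕ → ℕ → Ω → ℕ
  /-- the access attempt of device `i` in slot `m` is not deferred by the access scheme -/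
  unrestricted : ℕ → ℕ → Ω → Bool
  /-- channel power gain from device `i` to the typical base station in slot `m` -/
  fadeOut : ℕ → ℕ → Ω → ℝ
  /-- number of active devices in the typical cell in slot `m` -/
  cellCount : ℕ → Ω → ℕ
  /-- channel power gains of the active devices of the typical cell in slot `m`, in an enumeration
  `0, …, cellCount m - 1` of these devices that starts with the tagged one -/
  fadeIn : ℕ → ℕ → Ω → ℝ

namespace RachElements

variable {Ω : Type*}

/-- Device `i` is active in slot `m`: it has packets to send and is not restricted. -/
def Active (E : RachElements Ω) (m i : ℕ) (ω : Ω) : Prop :=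
  0 < E.newPackets m i ω + E.cumPackets m i ω ∧ E.unrestricted m i ω = true

/-- Transmit power `P i = ρ * r i ^ α` of device `i`. -/
noncomputable def power (E : RachElements Ω) (p : RachParams) (i : ℕ) (ω : Ω) : ℝ :=
  p.ρ * E.serve i ω ^ p.α

/-- Aggregate intra-cell interference: all active devices of the cell but the tagged one,
each received with mean power `ρ`. -/
noncomputable def intraInterference (E : RachElements Ω) (p : RachParams) (m : ℕ) (ω : Ω) : ℝ≥0∞ :=
  ∑ j ∈ Finset.Ico 1 (E.cellCount m ω), ENNReal.ofReal (p.ρ * E.fadeIn m j ω)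

open Classical in
/-- Aggregate inter-cell interference: all active devices that are closer to another base station
than to the typical one. -/
noncomputable def interInterference (E : RachElements Ω) (p : RachParams) (m : ℕ) (ω : Ω) : ℝ≥0∞ :=
  ∑' i : ℕ, if E.serve i ω < ‖E.u i ω‖ ∧ E.Active m i ω then
    ENNReal.ofReal (E.power p i ω * E.fadeOut m i ω * ‖E.u i ω‖ ^ (-p.α)) else 0

/-- The signal-to-interference-plus-noise ratio of the tagged device at the typical station. -/
noncomputable def sinr (E : RachElements Ω) (p : RachParams) (m : ℕ) (ω : Ω) : ℝ≥0∞ :=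
  ENNReal.ofReal (p.ρ * E.fadeIn m 0 ω) /
    (E.intraInterference p m ω + E.interInterference p m ω + ENNReal.ofReal p.noise)

variable [MeasurableSpace Ω]

/-- The non-empty probability `T` of a device in slot `m`. -/
noncomputable def nonEmptyProb (E : RachElements Ω) (μ : Measure Ω) (m : ℕ) : ℝ :=
  μ.real {ω | 0 < E.newPackets m 0 ω + E.cumPackets m 0 ω}

/-- The non-restrict probability `R` of a device in slot `m`. -/
noncomputable def nonRestrictProb (E : RachElements Ω) (μ : Measure Ω) (m : ℕ) : ℝ :=
  μ.real {ω | E.unrestricted m 0 ω = true}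

/-- Intensity `T * R * lamDp` of the active devices that use one given preamble in slot `m`. -/
noncomputable def activeIntensity (E : RachElements Ω) (p : RachParams) (μ : Measure Ω) (m : ℕ) :
    ℝ :=
  E.nonEmptyProb μ m * E.nonRestrictProb μ m * p.lamDp

/-- The preamble detection probability in slot `m`: the probability that the SINR of the tagged
device reaches the threshold, given that the typical cell holds an active device. -/
noncomputable def detectionProb (E : RachElements Ω) (p : RachParams) (μ : Measure Ω) (m : ℕ) :
    ℝ :=
  (ProbabilityTheory.cond μ {ω | 1 ≤ E.cellCount m ω}).real
    {ω | ENNReal.ofReal p.γ ≤ E.sinr p m ω}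

end RachElements

/-- Labels of the independent sources of randomness of a slot. -/
inductive RachSource where
  | stations
  | points
  | count
  | serve (i : ℕ)
  | buffer (i : ℕ)
  | unrestricted (i : ℕ)
  | fadeOut (i : ℕ)
  | fadeIn (j : ℕ)

/-- The σ-algebra generated by a source of randomness in slot `m`. -/
@[reducible]
def RachElements.sourceSigma {Ω : Type*} (E : RachElements Ω) (m : ℕ) :
    RachSource → MeasurableSpace Ω
  | .stations => MeasurableSpace.comap (fun ω i => E.bs i ω) inferInstance
  | .points => MeasurableSpace.comap (fun ω i => E.u i ω) inferInstance
  | .count => MeasurableSpace.comap (E.cellCount m) inferInstance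
  | .serve i => MeasurableSpace.comap (E.serve i) inferInstance
  | .buffer i =>
      MeasurableSpace.comap (fun ω => (E.newPackets m i ω, E.cumPackets m i ω)) inferInstance
  | .unrestricted i => MeasurableSpace.comap (E.unrestricted m i) inferInstance
  | .fadeOut i => MeasurableSpace.comap (E.fadeOut m i) inferInstance
  | .fadeIn j => MeasurableSpace.comap (E.fadeIn m j) inferInstance

/-- The network model with independently thinned devices and independent transmit powers. -/
structure IsRachModel {Ω : Type*} [MeasurableSpace Ω] (μ : Measure Ω) (p : RachParams)
    (E : RachElements Ω) : Prop where
  /-- base stations form a Poisson point process -/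
  bs_ppp : IsHomogeneousPPP μ E.bs p.lamB
  /-- devices using the tagged preamble form a Poisson point process -/
  u_ppp : IsHomogeneousPPP μ E.u p.lamDp
  /-- `r i` is distributed as the distance from a fixed location to its closest base station -/
  serve_law : ∀ i, IdentDistrib (E.serve i) (fun ω => ⨅ k, ‖E.bs k ω‖) μ μ
  serve_measurable : ∀ i, Measurable (E.serve i)
  newPackets_measurable : ∀ m i, Measurable (E.newPackets m i)
  cumPackets_measurable : ∀ m i, Measurable (E.cumPackets m i)
  /-- the buffers of the devices are identically distributed -/
  buffer_law : ∀ m i, IdentDistrib (fun ω => (E.newPackets m i ω, E.cumPackets m i ω))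
    (fun ω => (E.newPackets m 0 ω, E.cumPackets m 0 ω)) μ μ
  unrestricted_measurable : ∀ m i, Measurable (E.unrestricted m i)
  unrestricted_law : ∀ m i, IdentDistrib (E.unrestricted m i) (E.unrestricted m 0) μ μ
  fadeOut_measurable : ∀ m i, Measurable (E.fadeOut m i)
  /-- Rayleigh fading: unit mean exponential power gains -/
  fadeOut_law : ∀ m i, μ.map (E.fadeOut m i) = expMeasure 1
  fadeIn_measurable : ∀ m j, Measurable (E.fadeIn m j)
  fadeIn_law : ∀ m j, μ.map (E.fadeIn m j) = expMeasure 1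
  cellCount_measurable : ∀ m, Measurable (E.cellCount m)
  /-- law of the number of active devices in a randomly chosen cell -/
  cellCount_law : ∀ m n, μ {ω | E.cellCount m ω = n} =
    ENNReal.ofReal (cellCountPMF (E.activeIntensity p μ m / p.lamB) n)
  /-- in each slot all sources of randomness are mutually independent -/
  indep : ∀ m, iIndep (E.sourceSigma m) μ

/-! Since `ρ h₀` is exponential with mean `ρ` and independent of everything else, detection given
noise plus interference `J` has probability `exp (-γ J / ρ)` (`measure_detection`). The exponential
turns the sum `J` into a product, and the intra-cell and inter-cell interference depend on disjoint
sets of independent sources. So the joint probability of detection and a non-empty cell is a product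
of three Laplace transforms at `γ / ρ` (`measure_detection_eq_mul`), and it remains to divide by the
probability of a non-empty cell.

Intra-cell factor: with `n + 1` active devices there are `n` interferers, each contributing `1 / (1
+ γ)`. The cell size is negative binomial, so the binomial series gives its generating function;
removing the empty-cell term and dividing by `z = 1 / (1 + γ)` gives the bracket and the factor `1 +
γ`.

Inter-cell factor: the marks (serving distance, buffer, restriction, gain) are independent of the
positions and of each other, so averaging over them leaves the expectation of a product of `s(u i)`,
where `s` is `survivalProb`. For a Poisson process this is `exp (-lamDp ∫ (1 - s))`
(`IsHomogeneousPPP.laplace`). Here `1 - s` is `T R` times the mean of `lossTerm` over the serving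
distance `r`. Scaling the plane by `r γ ^ (1 / α)` makes its integral `r ^ 2 γ ^ (2 / α)` times `2
π` times the integral of the claim. Finally the void probabilities of the stations give `E r ^ 2 = 1
/ (π lamB)`, which cancels `π`.

All transforms take values in `ℝ≥0∞`, so interference may be infinite a priori and no summability
has to be shown: `expNeg` is continuous and vanishes at `∞`. -/

/-! ### The exponential on the extended half-line. -/

/-- The function `x ↦ exp (-x)` on the extended nonnegative reals. -/
noncomputable def expNeg (x : ℝ≥0∞) : ℝ≥0∞ := EReal.exp (-(x : EReal))

@[simp] lemma expNeg_zero : expNeg 0 = 1 := by simp [expNeg]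

@[simp] lemma expNeg_top : expNeg ∞ = 0 := by simp [expNeg]

lemma expNeg_ofReal {a : ℝ} (ha : 0 ≤ a) :
    expNeg (ENNReal.ofReal a) = ENNReal.ofReal (Real.exp (-a)) := by
  rw [expNeg, EReal.coe_ennreal_ofReal, max_eq_left ha, ← EReal.coe_neg, EReal.exp_coe]

lemma expNeg_add (x y : ℝ≥0∞) : expNeg (x + y) = expNeg x * expNeg y := by
  induction x with
  | top => simp
  | coe x =>
    induction y with
    | top => simp
    | coe y =>
      rw [← ENNReal.ofReal_coe_nnreal, ← ENNReal.ofReal_coe_nnreal,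
        ← ENNReal.ofReal_add x.coe_nonneg y.coe_nonneg, expNeg_ofReal x.coe_nonneg,
        expNeg_ofReal y.coe_nonneg, expNeg_ofReal (add_nonneg x.coe_nonneg y.coe_nonneg), neg_add, Real.exp_add,
        ENNReal.ofReal_mul (Real.exp_nonneg _)]

lemma continuous_expNeg : Continuous expNeg :=
  ENNReal.continuous_exp.comp (continuous_neg.comp continuous_coe_ennreal_ereal)

lemma measurable_expNeg : Measurable expNeg := continuous_expNeg.measurable

lemma antitone_expNeg : Antitone expNeg := fun _ _ h =>
  EReal.exp_monotone (EReal.neg_le_neg_iff.2 (EReal.coe_ennreal_le_coe_ennreal_iff.2 h))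

lemma expNeg_le_one (x : ℝ≥0∞) : expNeg x ≤ 1 := by
  simpa using antitone_expNeg (zero_le : 0 ≤ x)

lemma expNeg_sum {ι : Type*} (s : Finset ι) (f : ι → ℝ≥0∞) :
    expNeg (∑ i ∈ s, f i) = ∏ i ∈ s, expNeg (f i) := by
  classical
  induction s using Finset.induction_on with
  | empty => simp
  | insert a s ha ih => rw [Finset.sum_insert ha, Finset.prod_insert ha, expNeg_add, ih]

lemma expNeg_mul_natCast (a : ℝ≥0∞) (n : ℕ) : expNeg (a * n) = expNeg a ^ n := by
  have := expNeg_sum (Finset.range n) (fun _ => a)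
  simpa [mul_comm] using this

/-- Every factor in `[0, 1]`, including `0`, is `expNeg` of an explicit exponent. This lets a
Laplace functional compute expectations of products of such factors over the points. -/
lemma exists_expNeg_eq {x : ℝ≥0∞} (hx : x ≤ 1) :
    expNeg (-(ENNReal.log x)).toENNReal = x := by
  rw [expNeg, EReal.coe_toENNReal, neg_neg, ENNReal.exp_log]
  rw [EReal.le_neg, neg_zero, ← ENNReal.log_one]
  exact ENNReal.log_monotone hx

lemma tendsto_expNeg_sum_range (f : ℕ → ℝ≥0∞) :
    Filter.Tendsto (fun n => ∏ i ∈ Finset.range n, expNeg (f i)) Filter.atTop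
      (nhds (expNeg (∑' i, f i))) := by
  simp_rw [← expNeg_sum]
  exact (continuous_expNeg.tendsto _).comp (ENNReal.tendsto_nat_tsum f)

/-! ### The unit exponential law, and Fubini for independent variables. -/

lemma expMeasure_one_eq : expMeasure 1 =
    (volume.restrict (Set.Ioi (0 : ℝ))).withDensity
      (fun h => ENNReal.ofReal (Real.exp (-h))) := by
  rw [expMeasure, gammaMeasure, ← withDensity_indicator measurableSet_Ioi]
  apply withDensity_congr_ae
  have : ∀ᵐ x : ℝ, x ≠ 0 := by simp [ae_iff]
  filter_upwards [this] with x hx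
  rw [gammaPDF_eq]
  by_cases h : 0 ≤ x
  · simp [h, lt_of_le_of_ne h hx.symm]
  · simp [h, not_lt.2 (not_le.1 h).le]

/-- The threshold is extended because it will be a multiple of the total interference, which is not
known to be finite. -/
lemma expMeasure_one_tail (x : ℝ≥0∞) :
    expMeasure 1 {h | x ≤ ENNReal.ofReal h} = expNeg x := by
  induction x with
  | top => simp
  | coe x =>
    have hm : MeasurableSet {h : ℝ | (x : ℝ≥0∞) ≤ ENNReal.ofReal h} :=
      measurableSet_le measurable_const ENNReal.measurable_ofReal
    rw [expMeasure_one_eq, withDensity_apply _ hm, Measure.restrict_restrict hm,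
      ← ENNReal.ofReal_coe_nnreal, expNeg_ofReal x.coe_nonneg]
    have hs : ({h : ℝ | ENNReal.ofReal (x : ℝ) ≤ ENNReal.ofReal h} ∩ Set.Ioi 0 : Set ℝ)
        =ᵐ[volume] (Set.Ioi (x : ℝ) : Set ℝ) := by
      have : ∀ᵐ y : ℝ, y ≠ x := by simp [ae_iff]
      filter_upwards [this] with y hy
      apply propext
      change (ENNReal.ofReal (x : ℝ) ≤ ENNReal.ofReal y ∧ 0 < y) ↔ (x : ℝ) < y
      have hx : (0 : ℝ) ≤ x := x.2
      constructor
      · rintro ⟨h1, h2⟩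
        exact lt_of_le_of_ne ((ENNReal.ofReal_le_ofReal_iff h2.le).1 h1) hy.symm
      · intro h
        exact ⟨ENNReal.ofReal_le_ofReal h.le, hx.trans_lt h⟩
    rw [Measure.restrict_congr_set hs, ← ofReal_integral_eq_lintegral_ofReal
      (integrableOn_exp_neg_Ioi _) (ae_of_all _ fun _ => Real.exp_nonneg _), integral_exp_neg_Ioi]

lemma expMeasure_one_laplace {s : ℝ} (hs : 0 ≤ s) :
    ∫⁻ h, expNeg (ENNReal.ofReal (s * h)) ∂(expMeasure 1) = ENNReal.ofReal (1 / (1 + s)) := by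
  rw [expMeasure_one_eq, lintegral_withDensity_eq_lintegral_mul _ (by fun_prop)
    (show Measurable fun h : ℝ => expNeg (ENNReal.ofReal (s * h)) from
      measurable_expNeg.comp (by fun_prop))]
  have h1 : -(1 + s) < 0 := by linarith
  have : ∀ h ∈ Set.Ioi (0 : ℝ), ((fun h => ENNReal.ofReal (Real.exp (-h))) *
      fun h => expNeg (ENNReal.ofReal (s * h))) h =
      ENNReal.ofReal (Real.exp (-(1 + s) * h)) := by
    intro h hh
    have hh' : (0 : ℝ) < h := hh
    rw [Pi.mul_apply, expNeg_ofReal (by positivity), ← ENNReal.ofReal_mul (Real.exp_nonneg _),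
      ← Real.exp_add]
    ring_nf
  rw [setLIntegral_congr_fun measurableSet_Ioi this, ← ofReal_integral_eq_lintegral_ofReal
    (integrableOn_exp_mul_Ioi h1 0) (ae_of_all _ fun _ => Real.exp_nonneg _),
    integral_exp_mul_Ioi h1]
  congr 1
  rw [mul_zero, Real.exp_zero, neg_div_neg_eq]

/-- Fubini for independent random variables. -/
lemma lintegral_comp_indepFun {Ω S T : Type*} [MeasurableSpace Ω] [MeasurableSpace S]
    [MeasurableSpace T] {μ : Measure Ω} [IsFiniteMeasure μ] {X : Ω → S} {Y : Ω → T}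
    (hX : Measurable X) (hY : Measurable Y) (h : IndepFun X Y μ) {F : S → T → ℝ≥0∞}
    (hF : Measurable (Function.uncurry F)) :
    ∫⁻ ω, F (X ω) (Y ω) ∂μ = ∫⁻ ω, ∫⁻ ω', F (X ω) (Y ω') ∂μ ∂μ := by
  have h1 := h.map_prod_eq_prod_map_map hX.aemeasurable hY.aemeasurable
  calc ∫⁻ ω, F (X ω) (Y ω) ∂μ = ∫⁻ z, Function.uncurry F z ∂(μ.map fun ω => (X ω, Y ω)) := by
        rw [lintegral_map hF (hX.prodMk hY)]; rfl
    _ = ∫⁻ x, ∫⁻ y, F x y ∂(μ.map Y) ∂(μ.map X) := by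
        rw [h1, lintegral_prod _ hF.aemeasurable]; rfl
    _ = ∫⁻ ω, ∫⁻ y, F (X ω) y ∂(μ.map Y) ∂μ := by
        rw [lintegral_map (f := fun x => ∫⁻ y, F x y ∂(μ.map Y)) hF.lintegral_prod_right' hX]
    _ = _ := by
        refine lintegral_congr fun ω => ?_
        rw [lintegral_map (f := F (X ω)) (hF.comp measurable_prodMk_left) hY]

/-! ### The negative binomial law of the cell size. -/

lemma Gamma_natCast_add {c : ℝ} (hc : 0 < c) (n : ℕ) :
    Real.Gamma (n + c) = (ascPochhammer ℝ n).eval c * Real.Gamma c := by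
  induction n with
  | zero => simp
  | succ n ih =>
    have h : (n : ℝ) + c ≠ 0 := by positivity
    rw [show ((n + 1 : ℕ) : ℝ) + c = (n + c) + 1 by push_cast; ring, Real.Gamma_add_one h, ih,
      ascPochhammer_succ_eval]
    ring

/-- Identifies the Gamma quotient in the cell-size law with the coefficient of the series of `(1 -
y) ^ (-c)`. -/
lemma ringChoose_eq_Gamma {c : ℝ} (hc : 0 < c) (n : ℕ) :
    Ring.choose (c + n - 1) n = Real.Gamma (n + c) / (Real.Gamma c * Real.Gamma (n + 1)) := by
  have hG := (Real.Gamma_pos_of_pos hc).ne'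
  rw [Gamma_natCast_add hc, Real.Gamma_nat_eq_factorial, Ring.choose_eq_smul,
    Polynomial.descPochhammer_smeval_eq_ascPochhammer,
    Polynomial.ascPochhammer_smeval_cast, Polynomial.ascPochhammer_smeval_eq_eval]
  rw [show c + n - 1 - n + 1 = c by ring]
  have : (n.factorial : ℝ) ≠ 0 := by positivity
  simp
  field_simp

lemma hasSum_ringChoose_mul_pow {c y : ℝ} (hy : 0 ≤ y) (hy1 : y < 1) :
    HasSum (fun n : ℕ => Ring.choose (c + n - 1) n * y ^ n) ((1 - y) ^ (-c)) := by
  have h := (Real.one_div_one_sub_rpow_hasFPowerSeriesOnBall_zero c).hasSum (y := y)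
    (by simp [enorm_eq_nnnorm, ← NNReal.coe_lt_coe, abs_of_nonneg hy, hy1])
  simp only [FormalMultilinearSeries.ofScalars_apply_eq, zero_add, smul_eq_mul] at h
  rw [Real.rpow_neg (by linarith), ← one_div]
  exact h

lemma cellConst_pos : 0 < cellConst := by norm_num [cellConst]

/-- Generating function of the approximate number of devices in a cell. -/
lemma hasSum_cellCountPMF_mul_pow {x z : ℝ} (hx : 0 < x) (hz : 0 ≤ z) (hz1 : z ≤ 1) :
    HasSum (fun n : ℕ => cellCountPMF x n * z ^ n)
      ((1 + x * (1 - z) / cellConst) ^ (-cellConst)) := by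
  have hc := cellConst_pos
  set c := cellConst with hcdef
  have hxc : 0 < x + c := by positivity
  -- The law is negative binomial with success parameter `x / (x + c)`, so the series is taken at `y
  -- = x z / (x + c)`, which is below `1` because `z ≤ 1` and `c > 0`.
  have h := (hasSum_ringChoose_mul_pow (c := c) (y := x * z / (x + c)) (by positivity)
    (by rw [div_lt_one hxc]; nlinarith)).mul_left (c ^ c / (x + c) ^ c)
  have hterm : (fun n : ℕ => cellCountPMF x n * z ^ n) = fun n : ℕ =>
      c ^ c / (x + c) ^ c * (Ring.choose (c + n - 1) n * (x * z / (x + c)) ^ n) := by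
    funext n
    rw [ringChoose_eq_Gamma hc, cellCountPMF, Real.rpow_add hxc, Real.rpow_natCast]
    rw [← hcdef]
    have := (Real.Gamma_pos_of_pos hc).ne'
    have := (Real.Gamma_pos_of_pos (show (0:ℝ) < n + 1 by positivity)).ne'
    have := (Real.rpow_pos_of_pos hxc c).ne'
    rw [div_pow, mul_pow]
    field_simp
  have hsum : (1 + x * (1 - z) / c) ^ (-c) =
      c ^ c / (x + c) ^ c * (1 - x * z / (x + c)) ^ (-c) := by
    have h1 : 1 - x * z / (x + c) = (1 + x * (1 - z) / c) * (c / (x + c)) := by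
      field_simp; ring
    have h2 : 0 ≤ 1 + x * (1 - z) / c := by
      have : 0 ≤ x * (1 - z) / c := div_nonneg (mul_nonneg hx.le (by linarith)) hc.le
      linarith
    rw [h1, Real.mul_rpow h2 (by positivity), Real.rpow_neg (by positivity : 0 ≤ c / (x + c)),
      Real.div_rpow hc.le hxc.le]
    have := (Real.rpow_pos_of_pos hxc c).ne'
    have := (Real.rpow_pos_of_pos hc c).ne'
    field_simp
  rw [hterm, hsum]
  exact h

lemma cellCountPMF_nonneg {x : ℝ} (hx : 0 ≤ x) (n : ℕ) : 0 ≤ cellCountPMF x n := by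
  have hc := cellConst_pos
  have := Real.Gamma_pos_of_pos hc
  have := Real.Gamma_pos_of_pos (show (0:ℝ) < n + cellConst by positivity)
  have := Real.Gamma_pos_of_pos (show (0:ℝ) < n + 1 by positivity)
  unfold cellCountPMF
  positivity

lemma cellCountPMF_zero {x : ℝ} (hx : 0 ≤ x) :
    cellCountPMF x 0 = (1 + x / cellConst) ^ (-cellConst) := by
  have hc := cellConst_pos
  have hG := (Real.Gamma_pos_of_pos hc).ne'
  have hxc : 0 < x + cellConst := by positivity
  rw [show 1 + x / cellConst = (x + cellConst) / cellConst by field_simp; ring,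
    Real.rpow_neg (by positivity), Real.div_rpow hxc.le hc.le]
  simp [cellCountPMF]
  field_simp

/-! ### The Laplace functional of a Poisson point process. -/

lemma coe_pointCount {Ω : Type*} (X : ℕ → Ω → Plane) (A : Set Plane) (ω : Ω) :
    ((pointCount X A ω : ℕ∞) : ℝ≥0∞) = ∑' i, A.indicator 1 (X i ω) := by
  rw [pointCount, ← ENNReal.tsum_set_one, tsum_subtype {i : ℕ | X i ω ∈ A} (fun _ => (1 : ℝ≥0∞))]
  rfl

section PoissonPointProcess

variable {Ω : Type*} [MeasurableSpace Ω] {μ : Measure Ω} {X : ℕ → Ω → Plane} {lam : ℝ}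

lemma measurable_pointCount (hX : ∀ i, Measurable (X i)) {A : Set Plane} (hA : MeasurableSet A) :
    Measurable (pointCount X A) := by
  have h : Measurable fun ω => ((pointCount X A ω : ℕ∞) : ℝ≥0∞) := by
    simp_rw [coe_pointCount]
    exact Measurable.tsum fun i => (measurable_one.indicator hA).comp (hX i)
  refine measurable_to_countable' fun k => ?_
  have : pointCount X A ⁻¹' {k} =
      (fun ω => ((pointCount X A ω : ℕ∞) : ℝ≥0∞)) ⁻¹' {(k : ℝ≥0∞)} := by
    ext ω; simp
  rw [this]
  exact h (measurableSet_singleton _)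

lemma hasSum_poisson_mul_pow (m q : ℝ) :
    HasSum (fun k : ℕ => Real.exp (-m) * m ^ k / (k.factorial : ℝ) * q ^ k)
      (Real.exp (-(m * (1 - q)))) := by
  have h := (NormedSpace.expSeries_div_hasSum_exp (m * q)).mul_left (Real.exp (-m))
  rw [← Real.exp_eq_exp_ℝ, ← Real.exp_add] at h
  rw [show -m + m * q = -(m * (1 - q)) by ring] at h
  refine h.congr_fun fun k => ?_
  rw [mul_pow]
  ring

/-- Laplace transform of the number of points in a set. -/
lemma IsHomogeneousPPP.lintegral_expNeg_count (h : IsHomogeneousPPP μ X lam) (hl : 0 ≤ lam)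
    [IsProbabilityMeasure μ] {A : Set Plane} (hA : MeasurableSet A) (hv : volume A ≠ ∞)
    (a : ℝ≥0∞) :
    ∫⁻ ω, expNeg (a * (pointCount X A ω : ℕ∞)) ∂μ =
      expNeg (ENNReal.ofReal lam * ((1 - expNeg a) * volume A)) := by
  -- For `a ≠ 0` the value `k = ⊤` contributes `expNeg ∞ = 0`, so the expectation reduces to a sum
  -- over finite counts. This fails for `a = 0`, where both sides are `1`.
  rcases eq_or_ne a 0 with rfl | ha
  · simp
  have hN := measurable_pointCount h.measurable hA
  set m := lam * (volume A).toReal with hm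
  have hm0 : 0 ≤ m := by positivity
  have hq1 : expNeg a ≠ ∞ := ne_top_of_le_ne_top ENNReal.one_ne_top (expNeg_le_one a)
  set q := (expNeg a).toReal with hq
  have hq0 : 0 ≤ q := ENNReal.toReal_nonneg
  have hqa : expNeg a = ENNReal.ofReal q := (ENNReal.ofReal_toReal hq1).symm
  have hqle : q ≤ 1 := by
    simpa using ENNReal.toReal_mono ENNReal.one_ne_top (expNeg_le_one a)
  have e1 : ∫⁻ ω, expNeg (a * (pointCount X A ω : ℕ∞)) ∂μ =
      ∑' k : ℕ∞, expNeg (a * (k : ℝ≥0∞)) * μ (pointCount X A ⁻¹' {k}) := by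
    rw [← lintegral_map (f := fun k : ℕ∞ => expNeg (a * (k : ℝ≥0∞))) (measurable_of_countable _) hN,
      lintegral_countable']
    refine tsum_congr fun k => ?_
    rw [Measure.map_apply hN (measurableSet_singleton _)]
  have e2 : ∑' k : ℕ∞, expNeg (a * (k : ℝ≥0∞)) * μ (pointCount X A ⁻¹' {k}) =
      ∑' k : ℕ, expNeg (a * ((k : ℕ∞) : ℝ≥0∞)) * μ (pointCount X A ⁻¹' {(k : ℕ∞)}) := by
    refine (Function.Injective.tsum_eq (g := fun k : ℕ => (k : ℕ∞)) Nat.cast_injective ?_).symm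
    intro k hk
    induction k using ENat.recTopCoe with
    | top => simp [ENNReal.mul_top ha] at hk
    | coe k => exact ⟨k, rfl⟩
  have e3 : ∀ k : ℕ, expNeg (a * ((k : ℕ∞) : ℝ≥0∞)) * μ (pointCount X A ⁻¹' {(k : ℕ∞)}) =
      ENNReal.ofReal (Real.exp (-m) * m ^ k / (k.factorial : ℝ) * q ^ k) := by
    intro k
    have := h.count_law A hA hv k
    rw [show pointCount X A ⁻¹' {(k : ℕ∞)} = {ω | pointCount X A ω = k} from rfl, this,
      ENat.toENNReal_coe, expNeg_mul_natCast, hqa, ← ENNReal.ofReal_pow hq0, mul_comm,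
      ← ENNReal.ofReal_mul (by positivity)]
  rw [e1, e2, tsum_congr e3, ← ENNReal.ofReal_tsum_of_nonneg (fun k => by positivity)
    (hasSum_poisson_mul_pow m q).summable, (hasSum_poisson_mul_pow m q).tsum_eq, hqa,
    ← ENNReal.ofReal_one, ← ENNReal.ofReal_sub _ hq0, ← ENNReal.ofReal_toReal hv,
    ← ENNReal.ofReal_mul (by linarith), ← ENNReal.ofReal_mul hl, expNeg_ofReal]
  · rw [hm]; ring_nf
  · exact mul_nonneg hl (mul_nonneg (by linarith) ENNReal.toReal_nonneg)

lemma IsHomogeneousPPP.iIndepFun_of_fintype (h : IsHomogeneousPPP μ X lam) {ι : Type*} [Fintype ι]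
    {A : ι → Set Plane} (hA : ∀ j, MeasurableSet (A j))
    (hd : Pairwise fun j k => Disjoint (A j) (A k)) :
    iIndepFun (fun j ω => pointCount X (A j) ω) μ := by
  let e := Fintype.equivFin ι
  have := (h.indep _ (fun j => A (e.symm j)) (fun j => hA _)
    (fun j k hjk => hd (e.symm.injective.ne hjk))).precomp e.injective
  simpa using this

/-- Laplace functional of a Poisson point process for step functions. -/
lemma IsHomogeneousPPP.laplace_simpleFunc (h : IsHomogeneousPPP μ X lam) (hl : 0 ≤ lam)
    [IsProbabilityMeasure μ] (g : SimpleFunc Plane ℝ≥0∞) (hg : volume (Function.support g) ≠ ∞) :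
    ∫⁻ ω, expNeg (∑' i, g (X i ω)) ∂μ =
      expNeg (ENNReal.ofReal lam * ∫⁻ x, (1 - expNeg (g x))) := by
  classical
  let s := g.range.filter (· ≠ 0)
  have hA : ∀ y : s, MeasurableSet (g ⁻¹' {(y : ℝ≥0∞)}) := fun y => g.measurableSet_fiber _
  have hv : ∀ y : s, volume (g ⁻¹' {(y : ℝ≥0∞)}) ≠ ∞ := fun y =>
    ne_top_of_le_ne_top hg (measure_mono fun x hx => by
      have : g x = y := hx
      have hy := (Finset.mem_filter.1 y.2).2
      simpa [Function.mem_support, this] using hy)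
  have hd : Pairwise fun y z : s => Disjoint (g ⁻¹' {(y : ℝ≥0∞)}) (g ⁻¹' {(z : ℝ≥0∞)}) :=
    fun y z hyz => Disjoint.preimage _ (by simpa using Subtype.coe_injective.ne hyz)
  -- Any `F` with `F 0 = 0` is constant on the level sets of `g`, and the zero level set, of
  -- infinite area, drops out. Used for the identity, to write the sum over points through counts,
  -- and for `1 - expNeg`, to compute the integral.
  have hdec : ∀ (F : ℝ≥0∞ → ℝ≥0∞), F 0 = 0 → ∀ x,
      F (g x) = ∑ y : s, F y * (g ⁻¹' {(y : ℝ≥0∞)}).indicator 1 x := by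
    intro F hF x
    rw [Finset.sum_coe_sort s (fun y => F y * (g ⁻¹' {y}).indicator 1 x)]
    by_cases hx : g x = 0
    · rw [hx, hF, Finset.sum_eq_zero]
      intro y hy
      have : g x ≠ y := by rw [hx]; exact (Finset.mem_filter.1 hy).2.symm
      simp [this]
    · rw [Finset.sum_eq_single (g x)]
      · simp
      · intro y _ hy
        simp [hy.symm]
      · intro hn
        exact absurd (Finset.mem_filter.2 ⟨g.mem_range_self x, hx⟩) hn
  have e1 : ∀ ω, expNeg (∑' i, g (X i ω)) =
      ∏ y : s, expNeg (y * (pointCount X (g ⁻¹' {(y : ℝ≥0∞)}) ω : ℕ∞)) := by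
    intro ω
    rw [← expNeg_sum]
    congr 1
    have hid := hdec (fun y => y) rfl
    simp_rw [hid, coe_pointCount, ← ENNReal.tsum_mul_left]
    rw [Summable.tsum_finsetSum fun _ _ => ENNReal.summable]
  have hind := (h.iIndepFun_of_fintype hA hd).comp
    (fun (y : s) (k : ℕ∞) => expNeg ((y : ℝ≥0∞) * (k : ℝ≥0∞))) (fun y => measurable_of_countable _)
  simp_rw [e1]
  refine (lintegral_prod_eq_prod_lintegral_of_indepFun Finset.univ _ hind fun y =>
    (measurable_of_countable _).comp (measurable_pointCount h.measurable (hA y))).trans ?_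
  have e2 : ∫⁻ x, (1 - expNeg (g x)) =
      ∑ y : s, (1 - expNeg y) * volume (g ⁻¹' {(y : ℝ≥0∞)}) := by
    simp_rw [hdec (fun y => 1 - expNeg y) (by simp)]
    rw [lintegral_finsetSum _ fun y _ => (measurable_one.indicator (hA y)).const_mul _]
    refine Finset.sum_congr rfl fun y _ => ?_
    rw [lintegral_const_mul _ (measurable_one.indicator (hA y)), lintegral_indicator_one (hA y)]
  rw [e2, Finset.mul_sum, expNeg_sum]
  exact Finset.prod_congr rfl fun y _ => h.lintegral_expNeg_count hl (hA y) (hv y) y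

/-- Laplace functional of a Poisson point process. -/
lemma IsHomogeneousPPP.laplace (h : IsHomogeneousPPP μ X lam) (hl : 0 ≤ lam)
    [IsProbabilityMeasure μ] {v : Plane → ℝ≥0∞} (hv : Measurable v) :
    ∫⁻ ω, expNeg (∑' i, v (X i ω)) ∂μ =
      expNeg (ENNReal.ofReal lam * ∫⁻ x, (1 - expNeg (v x))) := by
  -- Cutting the simple approximations off at growing balls gives supports of finite area and keeps
  -- them increasing to `v`.
  let g : ℕ → SimpleFunc Plane ℝ≥0∞ := fun n =>
    (SimpleFunc.eapprox v n).restrict (Metric.ball 0 n)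
  have hgapp : ∀ n x, g n x = (Metric.ball (0 : Plane) n).indicator (SimpleFunc.eapprox v n) x :=
    fun n x => by rw [SimpleFunc.restrict_apply _ Metric.isOpen_ball.measurableSet]
  have hmono : ∀ x, Monotone fun n => g n x := by
    intro x m n hmn
    simp only [hgapp]
    refine (Set.indicator_le_indicator (SimpleFunc.monotone_eapprox v hmn x)).trans ?_
    exact Set.indicator_le_indicator_of_subset
      (Metric.ball_subset_ball (by exact_mod_cast hmn)) (fun _ => zero_le) x
  have hlim : ∀ x, Filter.Tendsto (fun n => g n x) Filter.atTop (nhds (v x)) := by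
    intro x
    have h1 : Filter.Tendsto (fun n => SimpleFunc.eapprox v n x) Filter.atTop (nhds (v x)) := by
      rw [← SimpleFunc.iSup_eapprox_apply hv x]
      exact tendsto_atTop_iSup fun m n hmn => SimpleFunc.monotone_eapprox v hmn x
    refine h1.congr' ?_
    obtain ⟨N, hN⟩ := exists_nat_gt ‖x‖
    filter_upwards [Filter.eventually_ge_atTop N] with n hn
    have : x ∈ Metric.ball (0 : Plane) n := by
      rw [mem_ball_zero_iff]
      exact hN.trans_le (by exact_mod_cast hn)
    rw [hgapp, Set.indicator_of_mem this]
  have hfin : ∀ n, volume (Function.support (g n)) ≠ ∞ := fun n =>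
    ne_top_of_le_ne_top (measure_ball_lt_top (x := (0 : Plane)) (r := n)).ne
      (measure_mono fun x hx => by
        by_contra hc
        exact hx (by rw [hgapp, Set.indicator_of_notMem hc]))
  have hL : Filter.Tendsto (fun n => ∫⁻ ω, expNeg (∑' i, g n (X i ω)) ∂μ) Filter.atTop
      (nhds (∫⁻ ω, expNeg (∑' i, v (X i ω)) ∂μ)) := by
    refine tendsto_lintegral_of_dominated_convergence (fun _ => 1)
      (fun n => measurable_expNeg.comp (Measurable.tsum fun i =>
        (g n).measurable.comp (h.measurable i))) (fun n => ae_of_all _ fun ω => expNeg_le_one _)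
      (by simp) (ae_of_all _ fun ω => (continuous_expNeg.tendsto _).comp ?_)
    -- Monotone convergence for the counting measure exchanges the sum over points with the
    -- supremum.
    have hs : ∀ ω, ∑' i, v (X i ω) = ⨆ n, ∑' i, g n (X i ω) := by
      intro ω
      simp_rw [← lintegral_count]
      rw [← lintegral_iSup (fun n => measurable_of_countable _)
        (fun m n hmn i => hmono (X i ω) hmn)]
      refine lintegral_congr fun i => ?_
      exact (iSup_eq_of_tendsto (hmono _) (hlim _)).symm
    rw [hs]
    exact tendsto_atTop_iSup fun m n hmn =>
      ENNReal.tsum_le_tsum fun i => hmono (X i ω) hmn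
  have hR : Filter.Tendsto (fun n => ∫⁻ x, (1 - expNeg (g n x))) Filter.atTop
      (nhds (∫⁻ x, (1 - expNeg (v x)))) := by
    refine lintegral_tendsto_of_tendsto_of_monotone
      (fun n => (measurable_const.sub (measurable_expNeg.comp (g n).measurable)).aemeasurable)
      (ae_of_all _ fun x m n hmn => tsub_le_tsub_left (antitone_expNeg (hmono x hmn)) _)
      (ae_of_all _ fun x => ?_)
    exact ENNReal.Tendsto.sub tendsto_const_nhds ((continuous_expNeg.tendsto _).comp (hlim x))
      (Or.inl ENNReal.one_ne_top)
  refine tendsto_nhds_unique hL ?_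
  simp_rw [fun n => h.laplace_simpleFunc hl (g n) (hfin n)]
  exact (continuous_expNeg.tendsto _).comp
    (ENNReal.Tendsto.const_mul hR (Or.inr ENNReal.ofReal_ne_top))

end PoissonPointProcess

/-! ### Planar integrals of the interference loss. -/

/-- The integrand is at most `y ^ (1 - α)`, integrable at infinity exactly because `α > 2`. -/
lemma integrableOn_div_one_add_rpow {α a : ℝ} (hα : 2 < α) (ha : 0 < a) :
    IntegrableOn (fun y : ℝ => y / (1 + y ^ α)) (Set.Ioi a) := by
  refine Integrable.mono' (integrableOn_Ioi_rpow_of_lt (show 1 - α < -1 by linarith) ha)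
    (Measurable.aestronglyMeasurable (by fun_prop)) ?_
  filter_upwards [self_mem_ae_restrict measurableSet_Ioi] with y hy
  have hy0 : 0 < y := ha.trans hy
  have hp : 0 < y ^ α := Real.rpow_pos_of_pos hy0 _
  rw [Real.norm_of_nonneg (by positivity), Real.rpow_sub hy0, Real.rpow_one]
  exact div_le_div_of_nonneg_left hy0.le hp (by linarith)

lemma volume_ball_zero_toReal {t : ℝ} (ht : 0 ≤ t) :
    (volume (Metric.ball (0 : Plane) t)).toReal = Real.pi * t ^ 2 := by
  rw [EuclideanSpace.volume_ball_fin_two]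
  simp [ht, Real.pi_pos.le, mul_comm]

/-- Polar coordinates: the circumference `2 π y` supplies both the factor `2 π` and the numerator
`y`. -/
lemma lintegral_radial_tail {α a : ℝ} (hα : 2 < α) (ha : 0 < a) :
    ∫⁻ w : Plane, (Set.Ioi a).indicator (fun y => ENNReal.ofReal (1 / (1 + y ^ α))) ‖w‖ =
      ENNReal.ofReal (2 * Real.pi * ∫ y in Set.Ioi a, y / (1 + y ^ α)) := by
  set f : ℝ → ℝ := (Set.Ioi a).indicator fun y => 1 / (1 + y ^ α) with hf
  have hf0 : ∀ w : Plane, 0 ≤ f ‖w‖ := fun w =>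
    Set.indicator_nonneg (fun y hy => by
      have : 0 < y := ha.trans hy
      positivity) _
  have e0 : ∀ w : Plane, (Set.Ioi a).indicator (fun y => ENNReal.ofReal (1 / (1 + y ^ α))) ‖w‖ =
      ENNReal.ofReal (f ‖w‖) := by
    intro w
    by_cases h : ‖w‖ ∈ Set.Ioi a <;> simp [hf, h]
  have e1 : (fun y : ℝ => y ^ (Module.finrank ℝ Plane - 1) • f y) =
      (Set.Ioi a).indicator fun y => y / (1 + y ^ α) := by
    funext y
    by_cases h : y ∈ Set.Ioi a
    · simp [hf, h, div_eq_mul_inv]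
    · simp [hf, h]
  have hint : Integrable (fun w : Plane => f ‖w‖) := by
    rw [integrable_fun_norm_addHaar volume, e1]
    exact ((integrable_indicator_iff measurableSet_Ioi).2
      (integrableOn_div_one_add_rpow hα ha)).integrableOn
  simp_rw [e0]
  rw [← ofReal_integral_eq_lintegral_ofReal hint (ae_of_all _ hf0),
    integral_fun_norm_addHaar volume f, e1, setIntegral_indicator measurableSet_Ioi,
    Set.inter_eq_right.2 (Set.Ioi_subset_Ioi ha.le), Measure.real,
    volume_ball_zero_toReal zero_le_one]
  congr 1
  simp
  ring

lemma lintegral_plane_smul {c : ℝ} (hc : 0 < c) {F : Plane → ℝ≥0∞} (hF : Measurable F) :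
    ∫⁻ u, F u = ENNReal.ofReal (c ^ 2) * ∫⁻ w, F (c • w) := by
  rw [← lintegral_map hF (measurable_const_smul c), Measure.map_addHaar_smul volume hc.ne',
    lintegral_smul_measure, smul_eq_mul, ← mul_assoc, ← ENNReal.ofReal_mul (by positivity)]
  have : c ^ 2 * |(c ^ Module.finrank ℝ Plane)⁻¹| = 1 := by
    rw [abs_of_pos (by positivity)]
    simp
    field_simp
  rw [this]
  simp

/-- One minus the Laplace transform of the Rayleigh faded interference that an active device at
position `u`, whose serving station is at distance `r`, causes at the origin. -/
noncomputable def lossTerm (γ α r : ℝ) (u : Plane) : ℝ≥0∞ :=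
  if r < ‖u‖ then ENNReal.ofReal (1 - 1 / (1 + γ * (r ^ α * ‖u‖ ^ (-α)))) else 0

lemma measurable_lossTerm (γ α : ℝ) : Measurable (Function.uncurry (lossTerm γ α)) := by
  unfold lossTerm
  refine Measurable.ite (measurableSet_lt measurable_fst measurable_snd.norm) ?_ measurable_const
  fun_prop

/-- Substituting `u = r γ ^ (1 / α) w` turns `γ (r / ‖u‖) ^ α` into `‖w‖ ^ (-α)` and the condition
`r < ‖u‖` into `‖w‖ > γ ^ (-1 / α)`. The Jacobian is `r ^ 2 γ ^ (2 / α)`. -/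
lemma lintegral_lossTerm {γ α r : ℝ} (hγ : 0 < γ) (hα : 2 < α) (hr : 0 ≤ r) :
    ∫⁻ u, lossTerm γ α r u = ENNReal.ofReal (r ^ 2) * ENNReal.ofReal (γ ^ (2 / α) *
      (2 * Real.pi * ∫ y in Set.Ioi (γ ^ (-1 / α)), y / (1 + y ^ α))) := by
  have hα0 : α ≠ 0 := by linarith
  -- The scaling needs `r > 0`; at `r = 0` the transmit power, hence the loss, is zero.
  rcases hr.eq_or_lt with rfl | hr
  · simp [lossTerm, Real.zero_rpow hα0]
  have hg : 0 < γ ^ (1 / α) := Real.rpow_pos_of_pos hγ _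
  have hc : 0 < r * γ ^ (1 / α) := mul_pos hr hg
  rw [lintegral_plane_smul hc (measurable_lossTerm γ α).of_uncurry_left]
  have key : ∀ w : Plane, lossTerm γ α r ((r * γ ^ (1 / α)) • w) =
      (Set.Ioi (γ ^ (-1 / α))).indicator (fun y => ENNReal.ofReal (1 / (1 + y ^ α))) ‖w‖ := by
    intro w
    have hn : ‖(r * γ ^ (1 / α)) • w‖ = r * γ ^ (1 / α) * ‖w‖ := by
      rw [norm_smul, Real.norm_of_nonneg hc.le]
    have hinv : γ ^ (-1 / α) = (γ ^ (1 / α))⁻¹ := by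
      rw [← Real.rpow_neg hγ.le]; ring_nf
    have hiff : r < ‖(r * γ ^ (1 / α)) • w‖ ↔ ‖w‖ ∈ Set.Ioi (γ ^ (-1 / α)) := by
      rw [hn, Set.mem_Ioi, hinv, inv_lt_iff_one_lt_mul₀ hg, mul_assoc]
      nth_rewrite 1 [← mul_one r]
      rw [mul_lt_mul_iff_right₀ hr, mul_comm]
    unfold lossTerm
    by_cases h : ‖w‖ ∈ Set.Ioi (γ ^ (-1 / α))
    · rw [if_pos (hiff.2 h), Set.indicator_of_mem h]
      have hw : 0 < ‖w‖ := (Real.rpow_pos_of_pos hγ _).trans h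
      have hp := Real.rpow_pos_of_pos hw α
      have e : γ * (r ^ α * ‖(r * γ ^ (1 / α)) • w‖ ^ (-α)) = (‖w‖ ^ α)⁻¹ := by
        rw [hn, Real.mul_rpow hc.le hw.le, Real.mul_rpow hr.le hg.le, ← Real.rpow_mul hγ.le,
          Real.rpow_neg hr.le, Real.rpow_neg hw.le, show 1 / α * -α = -1 by field_simp,
          Real.rpow_neg_one]
        have := (Real.rpow_pos_of_pos hr α).ne'
        field_simp
      rw [e]
      congr 1
      field_simp
      ring
    · rw [if_neg (mt hiff.1 h), Set.indicator_of_notMem h]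
  simp_rw [key]
  rw [lintegral_radial_tail hα (Real.rpow_pos_of_pos hγ _), mul_pow,
    ENNReal.ofReal_mul (by positivity), mul_assoc, ENNReal.ofReal_mul (p := γ ^ (2 / α))
    (by positivity)]
  congr 3
  rw [← Real.rpow_natCast, ← Real.rpow_mul hγ.le]
  congr 1
  push_cast
  ring

/-! ### Distance to the nearest station. -/

lemma iInf_norm_nonneg {Ω : Type*} (X : ℕ → Ω → Plane) (ω : Ω) : 0 ≤ ⨅ k, ‖X k ω‖ :=
  Real.iInf_nonneg fun _ => norm_nonneg _

section NearestStation

variable {Ω : Type*} [MeasurableSpace Ω] {μ : Measure Ω} {X : ℕ → Ω → Plane} {lam : ℝ}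

/-- Law of the distance from the origin to the closest point of a Poisson point process. -/
lemma IsHomogeneousPPP.measure_le_iInf_norm (h : IsHomogeneousPPP μ X lam) {t : ℝ} (ht : 0 ≤ t) :
    μ {ω | t ≤ ⨅ k, ‖X k ω‖} = ENNReal.ofReal (Real.exp (-(lam * (Real.pi * t ^ 2)))) := by
  -- Void probability: the nearest point is at distance at least `t` exactly when the open ball of
  -- radius `t` has no points.
  have := h.count_law (Metric.ball 0 t) Metric.isOpen_ball.measurableSet
    measure_ball_lt_top.ne 0
  rw [volume_ball_zero_toReal ht] at this
  simp only [pow_zero, mul_one, Nat.factorial_zero, Nat.cast_one, div_one] at this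
  rw [← this]
  congr 1
  ext ω
  have hb : BddBelow (Set.range fun k => ‖X k ω‖) := ⟨0, by rintro _ ⟨k, rfl⟩; exact norm_nonneg _⟩
  simp only [Set.mem_ofPred_eq, pointCount, Nat.cast_zero, Set.encard_eq_zero,
    Set.eq_empty_iff_forall_notMem, mem_ball_zero_iff, not_lt]
  exact ⟨fun hh k => hh.trans (ciInf_le hb k), fun hh => le_ciInf hh⟩

/-- Second moment of the distance to the closest point of a Poisson point process. -/
lemma IsHomogeneousPPP.lintegral_iInf_norm_sq (h : IsHomogeneousPPP μ X lam) (hl : 0 < lam) :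
    ∫⁻ ω, ENNReal.ofReal ((⨅ k, ‖X k ω‖) ^ 2) ∂μ = ENNReal.ofReal (1 / (Real.pi * lam)) := by
  have hm : Measurable fun ω => ⨅ k, ‖X k ω‖ := Measurable.iInf fun k => (h.measurable k).norm
  -- Layer cake: the second moment is `2 ∫ t P(t ≤ r) dt`, a Gaussian-type integral by the void
  -- probability.
  have e := lintegral_rpow_eq_lintegral_meas_le_mul μ (ae_of_all _ (iInf_norm_nonneg X))
    hm.aemeasurable two_pos
  have hb : 0 < lam * Real.pi := by positivity
  have hint : IntegrableOn (fun t : ℝ => t ^ (1 : ℝ) * Real.exp (-(lam * Real.pi) * t ^ (2 : ℝ)))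
      (Set.Ioi 0) := integrableOn_rpow_mul_exp_neg_mul_rpow (by norm_num) (by norm_num) hb
  have hval := integral_rpow_mul_exp_neg_mul_rpow (p := 2) (q := 1) two_pos (by norm_num) hb
  have hI : ∀ t ∈ Set.Ioi (0 : ℝ), μ {ω | t ≤ ⨅ k, ‖X k ω‖} * ENNReal.ofReal (t ^ ((2 : ℝ) - 1)) =
      ENNReal.ofReal (t ^ (1 : ℝ) * Real.exp (-(lam * Real.pi) * t ^ (2 : ℝ))) := by
    intro t ht
    have ht0 : (0 : ℝ) < t := ht
    rw [h.measure_le_iInf_norm ht0.le, ← ENNReal.ofReal_mul (Real.exp_nonneg _), mul_comm]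
    norm_num
    ring_nf
  rw [setLIntegral_congr_fun measurableSet_Ioi hI, ← ofReal_integral_eq_lintegral_ofReal hint
    (by
      filter_upwards [self_mem_ae_restrict measurableSet_Ioi] with t ht
      have ht0 : (0 : ℝ) < t := ht
      positivity), hval, ← ENNReal.ofReal_mul (by norm_num)] at e
  simp_rw [Real.rpow_two] at e
  rw [e]
  congr 1
  norm_num
  rw [Real.rpow_neg_one]
  field_simp

end NearestStation

/-! ### Blocks of independent sources, and marks of the devices. -/

namespace RachElements

variable {Ω : Type*} (E : RachElements Ω) (m : ℕ)

/-- The σ-algebra generated by a set of sources of randomness. -/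
@[reducible]
def blockSigma (S : Set RachSource) : MeasurableSpace Ω := ⨆ s ∈ S, E.sourceSigma m s

variable {E m}

lemma sourceSigma_le_blockSigma {S : Set RachSource} {s : RachSource} (hs : s ∈ S) :
    E.sourceSigma m s ≤ E.blockSigma m S :=
  le_iSup₂_of_le s hs le_rfl

lemma measurable_u_block {S : Set RachSource} (hs : .points ∈ S) (i : ℕ) :
    Measurable[E.blockSigma m S] (E.u i) :=
  Measurable.mono ((measurable_pi_apply i).comp
    (comap_measurable (fun ω i => E.u i ω))) (sourceSigma_le_blockSigma (m := m) hs) le_rfl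

lemma measurable_cellCount_block {S : Set RachSource} (hs : .count ∈ S) :
    Measurable[E.blockSigma m S] (E.cellCount m) :=
  (comap_measurable (E.cellCount m)).mono (sourceSigma_le_blockSigma hs) le_rfl

lemma measurable_serve_block {S : Set RachSource} {i : ℕ} (hs : .serve i ∈ S) :
    Measurable[E.blockSigma m S] (E.serve i) :=
  (comap_measurable (E.serve i)).mono (sourceSigma_le_blockSigma (m := m) hs) le_rfl

lemma measurable_buffer_block {S : Set RachSource} {i : ℕ} (hs : .buffer i ∈ S) :
    Measurable[E.blockSigma m S] (fun ω => (E.newPackets m i ω, E.cumPackets m i ω)) :=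
  (comap_measurable (fun ω => (E.newPackets m i ω, E.cumPackets m i ω))).mono
    (sourceSigma_le_blockSigma hs) le_rfl

lemma measurable_unrestricted_block {S : Set RachSource} {i : ℕ} (hs : .unrestricted i ∈ S) :
    Measurable[E.blockSigma m S] (E.unrestricted m i) :=
  (comap_measurable (E.unrestricted m i)).mono (sourceSigma_le_blockSigma hs) le_rfl

lemma measurable_fadeOut_block {S : Set RachSource} {i : ℕ} (hs : .fadeOut i ∈ S) :
    Measurable[E.blockSigma m S] (E.fadeOut m i) :=
  (comap_measurable (E.fadeOut m i)).mono (sourceSigma_le_blockSigma hs) le_rfl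

lemma measurable_fadeIn_block {S : Set RachSource} {i : ℕ} (hs : .fadeIn i ∈ S) :
    Measurable[E.blockSigma m S] (E.fadeIn m i) :=
  (comap_measurable (E.fadeIn m i)).mono (sourceSigma_le_blockSigma hs) le_rfl

variable (E m)

/-- Distance to the serving station, buffer state, access indicator and channel gain of a device. -/
def mark (i : ℕ) (ω : Ω) : ℝ × (ℕ × ℕ) × Bool × ℝ :=
  (E.serve i ω, (E.newPackets m i ω, E.cumPackets m i ω), E.unrestricted m i ω, E.fadeOut m i ω)

/-- The sources of randomness that determine the mark of a device. -/
def markSources (i : ℕ) : Set RachSource := {.serve i, .buffer i, .unrestricted i, .fadeOut i}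

variable {E m}

lemma measurable_mark_block {S : Set RachSource} {i : ℕ} (hs : markSources i ⊆ S) :
    Measurable[E.blockSigma m S] (E.mark m i) :=
  (measurable_serve_block (hs (by simp [markSources]))).prodMk
    ((measurable_buffer_block (hs (by simp [markSources]))).prodMk
      ((measurable_unrestricted_block (hs (by simp [markSources]))).prodMk
        (measurable_fadeOut_block (hs (by simp [markSources])))))

end RachElements

open Classical in
/-- Interference caused by a device at position `u` with the given mark. -/
noncomputable def markInterference (p : RachParams) (u : Plane) (x : ℝ × (ℕ × ℕ) × Bool × ℝ) :
    ℝ≥0∞ :=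
  if x.1 < ‖u‖ ∧ 0 < x.2.1.1 + x.2.1.2 ∧ x.2.2.1 = true then
    ENNReal.ofReal (p.ρ * x.1 ^ p.α * x.2.2.2 * ‖u‖ ^ (-p.α)) else 0

lemma measurable_markInterference (p : RachParams) :
    Measurable (Function.uncurry (markInterference p)) := by
  unfold markInterference
  refine Measurable.ite ?_ (by fun_prop) measurable_const
  have h1 : MeasurableSet {x : Plane × ℝ × (ℕ × ℕ) × Bool × ℝ | x.2.1 < ‖x.1‖} :=
    measurableSet_lt (by fun_prop) (by fun_prop)
  have h2 : MeasurableSet {x : Plane × ℝ × (ℕ × ℕ) × Bool × ℝ | 0 < x.2.2.1.1 + x.2.2.1.2} :=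
    measurableSet_lt (by fun_prop) (by fun_prop)
  have h3 : MeasurableSet {x : Plane × ℝ × (ℕ × ℕ) × Bool × ℝ | x.2.2.2.1 = true} :=
    (measurableSet_singleton true).preimage
      (f := fun x : Plane × ℝ × (ℕ × ℕ) × Bool × ℝ => x.2.2.2.1) (by fun_prop)
  exact h1.inter (h2.inter h3)

lemma Measurable.markInterference {β : Type*} [MeasurableSpace β] {f : β → Plane}
    {g : β → ℝ × (ℕ × ℕ) × Bool × ℝ} (hf : Measurable f) (hg : Measurable g) (p : RachParams) :
    Measurable fun b => markInterference p (f b) (g b) :=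
  (measurable_markInterference p).comp (hf.prodMk hg)

lemma RachElements.interInterference_eq_tsum {Ω : Type*} (E : RachElements Ω) (p : RachParams)
    (m : ℕ) (ω : Ω) :
    E.interInterference p m ω = ∑' i, markInterference p (E.u i ω) (E.mark m i ω) := by
  unfold RachElements.interInterference markInterference RachElements.mark RachElements.Active
    RachElements.power
  exact tsum_congr fun i => by congr

lemma RachElements.measurable_survival_term {Ω : Type*} [MeasurableSpace Ω] {E : RachElements Ω} (p : RachParams)
    {m i : ℕ} (hu : Measurable (E.u i))
    (hM : Measurable (E.mark m i)) : Measurable fun ω =>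
      expNeg (ENNReal.ofReal (p.γ / p.ρ) * markInterference p (E.u i ω) (E.mark m i ω)) :=
  measurable_expNeg.comp
    (((measurable_markInterference p).comp (hu.prodMk hM)).const_mul _)

/-- Probability that the interference of a device at position `u` does not exceed an independent
exponential threshold, given the position. -/
noncomputable def survivalProb {Ω : Type*} [MeasurableSpace Ω] (μ : Measure Ω) (p : RachParams)
    (E : RachElements Ω) (m : ℕ) (u : Plane) : ℝ≥0∞ :=
  1 - ENNReal.ofReal (E.nonEmptyProb μ m * E.nonRestrictProb μ m) *
    ∫⁻ ω, lossTerm p.γ p.α (⨅ k, ‖E.bs k ω‖) u ∂μ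

/-! ### Laplace transform of the inter-cell interference. -/

namespace IsRachModel

variable {Ω : Type*} [mΩ : MeasurableSpace Ω] {μ : Measure Ω}
  {p : RachParams} {E : RachElements Ω}

lemma sourceSigma_le (hE : IsRachModel μ p E) (m : ℕ) (s : RachSource) :
    E.sourceSigma m s ≤ mΩ := by
  cases s with
  | stations => exact (measurable_pi_lambda _ hE.bs_ppp.measurable).comap_le
  | points => exact (measurable_pi_lambda _ hE.u_ppp.measurable).comap_le
  | count => exact (hE.cellCount_measurable m).comap_le
  | serve i => exact (hE.serve_measurable i).comap_le
  | buffer i => exact ((hE.newPackets_measurable m i).prodMk (hE.cumPackets_measurable m i)).comap_le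
  | unrestricted i => exact (hE.unrestricted_measurable m i).comap_le
  | fadeOut i => exact (hE.fadeOut_measurable m i).comap_le
  | fadeIn j => exact (hE.fadeIn_measurable m j).comap_le

lemma blockSigma_le (hE : IsRachModel μ p E) (m : ℕ) (S : Set RachSource) :
    E.blockSigma m S ≤ mΩ :=
  iSup₂_le fun s _ => hE.sourceSigma_le m s

lemma indep_blockSigma [IsProbabilityMeasure μ] (hE : IsRachModel μ p E) (m : ℕ) {S T : Set RachSource}
    (hST : Disjoint S T) : Indep (E.blockSigma m S) (E.blockSigma m T) μ :=
  indep_iSup_of_disjoint (hE.sourceSigma_le m) (hE.indep m) hST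

/-- All later independence claims reduce to this: it suffices to list the sources each variable
depends on and check that the lists are disjoint. -/
lemma indepFun_of_block [IsProbabilityMeasure μ] (hE : IsRachModel μ p E) (m : ℕ) {S T : Set RachSource}
    (hST : Disjoint S T) {β β' : Type*} [MeasurableSpace β] [MeasurableSpace β'] {X : Ω → β}
    {Y : Ω → β'} (hX : Measurable[E.blockSigma m S] X) (hY : Measurable[E.blockSigma m T] Y) :
    IndepFun X Y μ := by
  rw [IndepFun_iff_Indep]
  exact indep_of_indep_of_le_left (indep_of_indep_of_le_right (hE.indep_blockSigma m hST)
    hY.comap_le) hX.comap_le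

lemma serve_nonneg (hE : IsRachModel μ p E) (i : ℕ) : ∀ᵐ ω ∂μ, 0 ≤ E.serve i ω :=
  (hE.serve_law i).symm.ae_snd (p := fun r => 0 ≤ r) measurableSet_Ici
    (ae_of_all _ (iInf_norm_nonneg E.bs))

lemma measure_buffer_nonempty [IsProbabilityMeasure μ] (hE : IsRachModel μ p E) (m i : ℕ) :
    μ {ω | 0 < E.newPackets m i ω + E.cumPackets m i ω} =
      ENNReal.ofReal (E.nonEmptyProb μ m) := by
  rw [RachElements.nonEmptyProb, ofReal_measureReal]
  exact (hE.buffer_law m i).measure_mem_eq (s := {x : ℕ × ℕ | 0 < x.1 + x.2})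
    (MeasurableSet.of_discrete)

lemma measure_unrestricted [IsProbabilityMeasure μ] (hE : IsRachModel μ p E) (m i : ℕ) :
    μ {ω | E.unrestricted m i ω = true} = ENNReal.ofReal (E.nonRestrictProb μ m) := by
  rw [RachElements.nonRestrictProb, ofReal_measureReal]
  exact (hE.unrestricted_law m i).measure_mem_eq (measurableSet_singleton true)

lemma measure_active [IsProbabilityMeasure μ] (hE : IsRachModel μ p E) (m i : ℕ) :
    μ {ω | E.Active m i ω} =
      ENNReal.ofReal (E.nonEmptyProb μ m * E.nonRestrictProb μ m) := by
  have hind := hE.indepFun_of_block m (S := {.buffer i}) (T := {.unrestricted i}) (by simp)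
    (RachElements.measurable_buffer_block (i := i) rfl)
    (RachElements.measurable_unrestricted_block (i := i) rfl)
  have := hind.measure_inter_preimage_eq_mul {x : ℕ × ℕ | 0 < x.1 + x.2} {true}
    MeasurableSet.of_discrete (measurableSet_singleton true)
  rw [ENNReal.ofReal_mul (show 0 ≤ E.nonEmptyProb μ m from measureReal_nonneg), ← hE.measure_buffer_nonempty m i,
    ← hE.measure_unrestricted m i]
  exact this

lemma measurableSet_active (hE : IsRachModel μ p E) (m i : ℕ) :
    MeasurableSet {ω | E.Active m i ω} :=
  (measurableSet_lt measurable_const ((hE.newPackets_measurable m i).add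
    (hE.cumPackets_measurable m i))).inter
    (hE.unrestricted_measurable m i (measurableSet_singleton true))

lemma lintegral_fadeOut (hE : IsRachModel μ p E) (m i : ℕ) {s : ℝ} (hs : 0 ≤ s) :
    ∫⁻ ω, expNeg (ENNReal.ofReal (s * E.fadeOut m i ω)) ∂μ = ENNReal.ofReal (1 / (1 + s)) := by
  rw [← expMeasure_one_laplace hs, ← hE.fadeOut_law m i,
    lintegral_map (f := fun h => expNeg (ENNReal.ofReal (s * h)))
      (measurable_expNeg.comp (by fun_prop)) (hE.fadeOut_measurable m i)]

lemma lintegral_fadeIn (hE : IsRachModel μ p E) (m i : ℕ) {s : ℝ} (hs : 0 ≤ s) :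
    ∫⁻ ω, expNeg (ENNReal.ofReal (s * E.fadeIn m i ω)) ∂μ = ENNReal.ofReal (1 / (1 + s)) := by
  rw [← expMeasure_one_laplace hs, ← hE.fadeIn_law m i,
    lintegral_map (f := fun h => expNeg (ENNReal.ofReal (s * h)))
      (measurable_expNeg.comp (by fun_prop)) (hE.fadeIn_measurable m i)]

lemma lintegral_active_mul_lossTerm [IsProbabilityMeasure μ] (hE : IsRachModel μ p E) (m i : ℕ) (u : Plane) :
    ∫⁻ ω, {ω | E.Active m i ω}.indicator 1 ω * lossTerm p.γ p.α (E.serve i ω) u ∂μ =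
      ENNReal.ofReal (E.nonEmptyProb μ m * E.nonRestrictProb μ m) *
        ∫⁻ ω, lossTerm p.γ p.α (⨅ k, ‖E.bs k ω‖) u ∂μ := by
  have hl : Measurable fun r => lossTerm p.γ p.α r u :=
    (measurable_lossTerm p.γ p.α).of_uncurry_right
  let f : (ℕ × ℕ) × Bool → ℝ≥0∞ := {x | 0 < x.1.1 + x.1.2 ∧ x.2 = true}.indicator 1
  have hind := hE.indepFun_of_block m (S := {.buffer i, .unrestricted i}) (T := {.serve i})
    (by simp)
    ((RachElements.measurable_buffer_block (i := i) (by simp)).prodMk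
      (RachElements.measurable_unrestricted_block (i := i) (by simp)))
    (RachElements.measurable_serve_block (i := i) rfl)
  have hf : Measurable f := measurable_of_countable f
  have hmul := lintegral_mul_eq_lintegral_mul_lintegral_of_indepFun
    (hf.comp (((hE.newPackets_measurable m i).prodMk (hE.cumPackets_measurable m i)).prodMk
      (hE.unrestricted_measurable m i))) (hl.comp (hE.serve_measurable i)) (hind.comp hf hl)
  have hfA : ∀ ω, f ((E.newPackets m i ω, E.cumPackets m i ω), E.unrestricted m i ω) =
      {ω | E.Active m i ω}.indicator 1 ω := fun ω => rfl
  simp only [Pi.mul_apply, Function.comp_apply, hfA] at hmul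
  rw [hmul, lintegral_indicator_one (hE.measurableSet_active m i), hE.measure_active]
  congr 1
  exact ((hE.serve_law i).comp hl).lintegral_eq

/-- An inactive or nearer device contributes factor `1`; otherwise the exponential gain contributes
`1` minus the loss. The result does not depend on `i`, as the marks share one law. The second part
shows that the truncated subtraction in `survivalProb` loses nothing. -/
lemma survivalProb_spec [IsProbabilityMeasure μ] (hE : IsRachModel μ p E) (m i : ℕ) (u : Plane) :
    ∫⁻ ω, expNeg (ENNReal.ofReal (p.γ / p.ρ) * markInterference p u (E.mark m i ω)) ∂μ =
        survivalProb μ p E m u ∧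
      1 - survivalProb μ p E m u =
        ENNReal.ofReal (E.nonEmptyProb μ m * E.nonRestrictProb μ m) *
          ∫⁻ ω, lossTerm p.γ p.α (⨅ k, ‖E.bs k ω‖) u ∂μ := by
  classical
  have hγ := p.γ_pos
  have hρ := p.ρ_pos
  have hl : Measurable fun r => lossTerm p.γ p.α r u :=
    (measurable_lossTerm p.γ p.α).of_uncurry_right
  let S : Set RachSource := {.serve i, .buffer i, .unrestricted i}
  have hX : Measurable[E.blockSigma m S] fun ω =>
      (E.serve i ω, (E.newPackets m i ω, E.cumPackets m i ω), E.unrestricted m i ω) :=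
    (RachElements.measurable_serve_block (by simp [S])).prodMk
      ((RachElements.measurable_buffer_block (by simp [S])).prodMk
        (RachElements.measurable_unrestricted_block (by simp [S])))
  have hind := hE.indepFun_of_block m (S := S) (T := {.fadeOut i}) (by simp [S]) hX
    (RachElements.measurable_fadeOut_block (i := i) rfl)
  have hfub := lintegral_comp_indepFun (hX.mono (hE.blockSigma_le m S) le_rfl)
    (hE.fadeOut_measurable m i) hind
    (F := fun x h => expNeg (ENNReal.ofReal (p.γ / p.ρ) *
      markInterference p u (x.1, x.2.1, x.2.2, h)))
    (measurable_expNeg.comp (((measurable_markInterference p).of_uncurry_left (x := u)).comp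
      (show Measurable fun z : (ℝ × (ℕ × ℕ) × Bool) × ℝ => (z.1.1, z.1.2.1, z.1.2.2, z.2) by
        fun_prop) |>.const_mul _))
  -- Averaging over the gain alone. The identity is stated as a sum equal to `1`, so that it can be
  -- integrated without truncated subtraction.
  have hinner : ∀ᵐ ω ∂μ, (∫⁻ ω', expNeg (ENNReal.ofReal (p.γ / p.ρ) * markInterference p u
      (E.serve i ω, (E.newPackets m i ω, E.cumPackets m i ω), E.unrestricted m i ω,
        E.fadeOut m i ω')) ∂μ) + {ω | E.Active m i ω}.indicator 1 ω *
          lossTerm p.γ p.α (E.serve i ω) u = 1 := by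
    filter_upwards [hE.serve_nonneg i] with ω hr
    by_cases ha : E.Active m i ω
    · by_cases hu : E.serve i ω < ‖u‖
      · have hk : 0 ≤ p.γ * (E.serve i ω ^ p.α * ‖u‖ ^ (-p.α)) := by positivity
        have e : ∀ ω', ENNReal.ofReal (p.γ / p.ρ) * markInterference p u
            (E.serve i ω, (E.newPackets m i ω, E.cumPackets m i ω), E.unrestricted m i ω,
              E.fadeOut m i ω') = ENNReal.ofReal (p.γ * (E.serve i ω ^ p.α * ‖u‖ ^ (-p.α)) *
                E.fadeOut m i ω') := by
          intro ω'
          rw [markInterference, if_pos ⟨hu, ha.1, ha.2⟩, ← ENNReal.ofReal_mul (by positivity)]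
          congr 1
          field_simp
        simp_rw [e]
        rw [hE.lintegral_fadeOut m i hk, Set.indicator_of_mem (by exact ha), Pi.one_apply, one_mul,
          lossTerm, if_pos hu, ← ENNReal.ofReal_add (by positivity)]
        · simp
        · rw [sub_nonneg, div_le_one (by linarith)]; linarith
      · simp [markInterference, lossTerm, hu]
    · have : ¬ (0 < E.newPackets m i ω + E.cumPackets m i ω ∧ E.unrestricted m i ω = true) := ha
      simp only [markInterference, this, and_false, if_false]
      simp [ha]
  have hsum := lintegral_congr_ae hinner
  rw [lintegral_add_right, hE.lintegral_active_mul_lossTerm, ← hfub, lintegral_one,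
    measure_univ] at hsum
  · set c := ENNReal.ofReal (E.nonEmptyProb μ m * E.nonRestrictProb μ m) *
          ∫⁻ ω, lossTerm p.γ p.α (⨅ k, ‖E.bs k ω‖) u ∂μ with hc
    have hc1 : c ≤ 1 := hsum ▸ le_add_self
    have hct : c ≠ ∞ := ne_top_of_le_ne_top ENNReal.one_ne_top hc1
    refine ⟨ENNReal.eq_sub_of_add_eq hct hsum, ?_⟩
    rw [survivalProb, ← hc, ENNReal.sub_sub_cancel ENNReal.one_ne_top hc1]
  · exact (measurable_one.indicator (hE.measurableSet_active m i)).mul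
      (hl.comp (hE.serve_measurable i))

lemma measurable_survivalProb [IsProbabilityMeasure μ] (hE : IsRachModel μ p E) (m : ℕ) :
    Measurable (survivalProb μ p E m) := by
  have hd : Measurable fun ω => ⨅ k, ‖E.bs k ω‖ :=
    Measurable.iInf fun k => (hE.bs_ppp.measurable k).norm
  have : Measurable fun z : Plane × Ω => lossTerm p.γ p.α (⨅ k, ‖E.bs k z.2‖) z.1 :=
    (measurable_lossTerm p.γ p.α).comp ((hd.comp measurable_snd).prodMk measurable_fst)
  exact measurable_const.sub (this.lintegral_prod_right'.const_mul _)

/-- Averaging over the marks of finitely many devices, given the positions. -/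
lemma lintegral_mul_prod_survival [IsProbabilityMeasure μ] (hE : IsRachModel μ p E) (m n : ℕ) {W : Ω → ℝ≥0∞}
    (hW : Measurable[E.blockSigma m {.points}] W) :
    ∫⁻ ω, W ω * ∏ i ∈ Finset.range n,
        expNeg (ENNReal.ofReal (p.γ / p.ρ) * markInterference p (E.u i ω) (E.mark m i ω)) ∂μ =
      ∫⁻ ω, W ω * ∏ i ∈ Finset.range n, survivalProb μ p E m (E.u i ω) ∂μ := by
  -- The mark of the last device is averaged first. The resulting factor depends only on its
  -- position, so it is absorbed into `W`, which must therefore be an arbitrary function of the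
  -- points.
  induction n generalizing W with
  | zero => simp
  | succ n ih =>
    let S : Set RachSource := {.points} ∪ ⋃ i ∈ Finset.range n, RachElements.markSources i
    have hpS : {RachSource.points} ⊆ S := Set.subset_union_left
    have hdis : Disjoint S (RachElements.markSources n) := by
      rw [Set.disjoint_left]
      rintro s hs hs'
      simp only [S, RachElements.markSources, Set.mem_union, Set.mem_iUnion,
        Set.mem_insert_iff, Set.mem_singleton_iff, Finset.mem_range] at hs hs'
      rcases hs' with rfl | rfl | rfl | rfl <;> simp at hs
    have hWS : Measurable[E.blockSigma m S] W :=
      hW.mono (biSup_mono fun s hs => hpS hs) le_rfl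
    have hu : ∀ i, Measurable[E.blockSigma m S] (E.u i) :=
      RachElements.measurable_u_block (hpS rfl)
    have hX : Measurable[E.blockSigma m S] fun ω => (W ω * ∏ i ∈ Finset.range n,
        expNeg (ENNReal.ofReal (p.γ / p.ρ) * markInterference p (E.u i ω) (E.mark m i ω)),
          E.u n ω) := by
      refine (hWS.mul (Finset.measurable_fun_prod _ fun i hi => ?_)).prodMk (hu n)
      refine @RachElements.measurable_survival_term Ω (E.blockSigma m S) E p m i (hu i)
        (RachElements.measurable_mark_block ?_)
      exact (Set.subset_biUnion_of_mem (u := fun i => RachElements.markSources i)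
        (show i ∈ (Finset.range n : Set ℕ) from hi)).trans Set.subset_union_right
    have hM : Measurable[E.blockSigma m (RachElements.markSources n)] (E.mark m n) :=
      RachElements.measurable_mark_block subset_rfl
    have hF : Measurable (Function.uncurry fun (x : ℝ≥0∞ × Plane) y =>
        x.1 * expNeg (ENNReal.ofReal (p.γ / p.ρ) * markInterference p x.2 y)) := by
      refine Measurable.mul (by fun_prop) (measurable_expNeg.comp (Measurable.const_mul
        (Measurable.markInterference (by fun_prop) (by fun_prop) p) _))
    have hG : ∀ u : Plane, Measurable fun ω => expNeg (ENNReal.ofReal (p.γ / p.ρ) *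
        markInterference p u (E.mark m n ω)) := fun u => measurable_expNeg.comp
      ((Measurable.markInterference measurable_const
        (hM.mono (hE.blockSigma_le m _) le_rfl) p).const_mul _)
    have hfub := lintegral_comp_indepFun (hX.mono (hE.blockSigma_le m S) le_rfl)
      (hM.mono (hE.blockSigma_le m _) le_rfl) (hE.indepFun_of_block m hdis hX hM) hF
    have hW' : Measurable[E.blockSigma m {.points}] fun ω =>
        W ω * survivalProb μ p E m (E.u n ω) :=
      have hun : Measurable[E.blockSigma m {.points}] (E.u n) :=
        RachElements.measurable_u_block (Set.mem_singleton _) n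
      hW.mul ((hE.measurable_survivalProb m).comp hun)
    have hih := ih hW'
    simp_rw [Finset.prod_range_succ, ← mul_assoc]
    refine hfub.trans ?_
    have : ∀ ω, ∫⁻ ω', (W ω * ∏ i ∈ Finset.range n, expNeg (ENNReal.ofReal (p.γ / p.ρ) *
        markInterference p (E.u i ω) (E.mark m i ω))) * expNeg (ENNReal.ofReal (p.γ / p.ρ) *
          markInterference p (E.u n ω) (E.mark m n ω')) ∂μ =
        W ω * survivalProb μ p E m (E.u n ω) * ∏ i ∈ Finset.range n,
          expNeg (ENNReal.ofReal (p.γ / p.ρ) * markInterference p (E.u i ω) (E.mark m i ω)) := by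
      intro ω
      rw [lintegral_const_mul _ (hG (E.u n ω)), (hE.survivalProb_spec m n _).1]
      ring
    simp_rw [this, hih]
    refine lintegral_congr fun ω => by ring

/-- Laplace transform of the inter-cell interference, in terms of the positions alone. -/
lemma lintegral_expNeg_inter_eq [IsProbabilityMeasure μ] (hE : IsRachModel μ p E) (m : ℕ) :
    ∫⁻ ω, expNeg (ENNReal.ofReal (p.γ / p.ρ) * E.interInterference p m ω) ∂μ =
      ∫⁻ ω, expNeg (∑' i, (-(ENNReal.log (survivalProb μ p E m (E.u i ω)))).toENNReal) ∂μ := by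
  have h1 : ∀ u, survivalProb μ p E m u ≤ 1 := fun u => tsub_le_self
  -- Infinite products are limits of finite ones, dominated by `1`, so it is enough to average over
  -- finitely many marks.
  have hlim : ∀ G : ℕ → Ω → ℝ≥0∞, (∀ i, Measurable (G i)) → Filter.Tendsto
      (fun n => ∫⁻ ω, ∏ i ∈ Finset.range n, expNeg (G i ω) ∂μ) Filter.atTop
      (nhds (∫⁻ ω, expNeg (∑' i, G i ω) ∂μ)) := fun G hG =>
    tendsto_lintegral_of_dominated_convergence (fun _ => 1)
      (fun n => Finset.measurable_fun_prod _ fun i _ => measurable_expNeg.comp (hG i))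
      (fun n => ae_of_all _ fun ω => Finset.prod_le_one' fun i _ => expNeg_le_one _)
      (by simp) (ae_of_all _ fun ω => tendsto_expNeg_sum_range _)
  have hmark : ∀ i, Measurable (E.mark m i) := fun i =>
    (RachElements.measurable_mark_block (m := m) subset_rfl).mono (hE.blockSigma_le m _) le_rfl
  simp_rw [RachElements.interInterference_eq_tsum, ← ENNReal.tsum_mul_left]
  refine tendsto_nhds_unique (hlim _ fun i => ((measurable_markInterference p).comp
    ((hE.u_ppp.measurable i).prodMk (hmark i))).const_mul _) ?_
  refine (hlim (fun i ω => (-(ENNReal.log (survivalProb μ p E m (E.u i ω)))).toENNReal)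
    fun i => ?_).congr fun n => ?_
  · exact measurable_ereal_toENNReal.comp (measurable_neg.comp
      (ENNReal.measurable_log.comp ((hE.measurable_survivalProb m).comp (hE.u_ppp.measurable i))))
  · simp_rw [exists_expNeg_eq (h1 _)]
    have := hE.lintegral_mul_prod_survival m n (W := fun _ => 1) measurable_const
    simpa using this.symm

/-- By Tonelli the planar integral comes first and is proportional to `r ^ 2`, so only the second
moment `1 / (π lamB)` of the serving distance enters. -/
lemma lintegral_lossTerm_serve [IsProbabilityMeasure μ] (hE : IsRachModel μ p E) :
    ∫⁻ u, ∫⁻ ω, lossTerm p.γ p.α (⨅ k, ‖E.bs k ω‖) u ∂μ =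
      ENNReal.ofReal (2 * p.γ ^ (2 / p.α) / p.lamB *
        ∫ y in Set.Ioi (p.γ ^ (-1 / p.α)), y / (1 + y ^ p.α)) := by
  have hγ := p.γ_pos
  have hB := p.lamB_pos
  have hd : Measurable fun ω => ⨅ k, ‖E.bs k ω‖ :=
    Measurable.iInf fun k => (hE.bs_ppp.measurable k).norm
  have hl : Measurable fun z : Plane × Ω => lossTerm p.γ p.α (⨅ k, ‖E.bs k z.2‖) z.1 :=
    (measurable_lossTerm p.γ p.α).comp ((hd.comp measurable_snd).prodMk measurable_fst)
  rw [lintegral_lintegral_swap hl.aemeasurable]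
  simp_rw [fun ω => lintegral_lossTerm hγ p.two_lt_α (iInf_norm_nonneg E.bs ω)]
  rw [lintegral_mul_const _ (by fun_prop), hE.bs_ppp.lintegral_iInf_norm_sq hB,
    ← ENNReal.ofReal_mul (by positivity)]
  congr 1
  have := Real.pi_pos.ne'
  field_simp

/-- Laplace transform of the inter-cell interference. -/
lemma lintegral_expNeg_inter [IsProbabilityMeasure μ] (hE : IsRachModel μ p E) (m : ℕ) :
    ∫⁻ ω, expNeg (ENNReal.ofReal (p.γ / p.ρ) * E.interInterference p m ω) ∂μ =
      ENNReal.ofReal (Real.exp (-(2 * p.γ ^ (2 / p.α) *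
        (E.nonEmptyProb μ m * E.nonRestrictProb μ m * p.lamDp / p.lamB) *
          ∫ y in Set.Ioi (p.γ ^ (-1 / p.α)), y / (1 + y ^ p.α)))) := by
  have hγ := p.γ_pos
  have hB := p.lamB_pos
  have hDp : 0 ≤ p.lamDp := div_nonneg p.lamD_pos.le (Nat.cast_nonneg _)
  have hT : 0 ≤ E.nonEmptyProb μ m := measureReal_nonneg
  have hR : 0 ≤ E.nonRestrictProb μ m := measureReal_nonneg
  have hI : 0 ≤ ∫ y in Set.Ioi (p.γ ^ (-1 / p.α)), y / (1 + y ^ p.α) :=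
    setIntegral_nonneg measurableSet_Ioi fun y hy => by
      have : 0 < y := (Real.rpow_pos_of_pos hγ _).trans hy
      positivity
  have hv : Measurable fun u => (-(ENNReal.log (survivalProb μ p E m u))).toENNReal :=
    measurable_ereal_toENNReal.comp (measurable_neg.comp
      (ENNReal.measurable_log.comp (hE.measurable_survivalProb m)))
  have hd : Measurable fun ω => ⨅ k, ‖E.bs k ω‖ :=
    Measurable.iInf fun k => (hE.bs_ppp.measurable k).norm
  have hκ : Measurable fun u => ∫⁻ ω, lossTerm p.γ p.α (⨅ k, ‖E.bs k ω‖) u ∂μ :=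
    ((measurable_lossTerm p.γ p.α).comp
      ((hd.comp measurable_snd).prodMk measurable_fst) :
        Measurable fun z : Plane × Ω => lossTerm p.γ p.α (⨅ k, ‖E.bs k z.2‖) z.1).lintegral_prod_right'
  rw [hE.lintegral_expNeg_inter_eq, hE.u_ppp.laplace hDp hv]
  simp_rw [fun u => exists_expNeg_eq (show survivalProb μ p E m u ≤ 1 from tsub_le_self),
    fun u => (hE.survivalProb_spec m 0 u).2]
  rw [lintegral_const_mul _ hκ, hE.lintegral_lossTerm_serve, ← ENNReal.ofReal_mul (by positivity),
    ← ENNReal.ofReal_mul hDp, expNeg_ofReal (by positivity)]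
  congr 3
  ring

end IsRachModel

/-! ### The intra-cell interference and the cell size. -/

namespace RachElements

variable {Ω : Type*} [MeasurableSpace Ω] {E : RachElements Ω} {m : ℕ}

lemma measurable_interInterference (p : RachParams) (hu : ∀ i, Measurable (E.u i))
    (hM : ∀ i, Measurable (E.mark m i)) : Measurable (E.interInterference p m) := by
  have : E.interInterference p m =
      fun ω => ∑' i, markInterference p (E.u i ω) (E.mark m i ω) :=
    funext (E.interInterference_eq_tsum p m)
  rw [this]
  exact Measurable.tsum fun i => (hu i).markInterference (hM i) p

/-- Only gains with index at least `1` are required, so this also applies to the σ-algebra that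
omits the tagged gain. -/
lemma measurable_intraInterference (p : RachParams) (hN : Measurable (E.cellCount m))
    (hF : ∀ j, 1 ≤ j → Measurable (E.fadeIn m j)) : Measurable (E.intraInterference p m) := by
  have h : Measurable fun z : ℕ × Ω => ∑ j ∈ Finset.Ico 1 z.1,
      ENNReal.ofReal (p.ρ * E.fadeIn m j z.2) :=
    measurable_from_prod_countable_right fun n => Finset.measurable_fun_sum _ fun j hj =>
      ((hF j (Finset.mem_Ico.1 hj).1).const_mul _).ennreal_ofReal
  exact h.comp (hN.prodMk measurable_id)

/-- Decomposition of the factor due to the intra-cell interference by the number of devices. -/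
lemma indicator_mul_expNeg_intra {Ω : Type*} (E : RachElements Ω) (p : RachParams) (m : ℕ) (ω : Ω) :
    {ω | 1 ≤ E.cellCount m ω}.indicator 1 ω *
        expNeg (ENNReal.ofReal (p.γ / p.ρ) * E.intraInterference p m ω) =
      ∑' n : ℕ, (E.cellCount m ⁻¹' {n + 1}).indicator 1 ω *
        ∏ j ∈ Finset.Ico 1 (n + 1), expNeg (ENNReal.ofReal (p.γ * E.fadeIn m j ω)) := by
  have hρ := p.ρ_pos
  have hγ := p.γ_pos
  rcases hN : E.cellCount m ω with _ | k
  · simp [hN]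
  · rw [tsum_eq_single k]
    · rw [Set.indicator_of_mem (show ω ∈ {ω | 1 ≤ E.cellCount m ω} by simp [hN]),
        Set.indicator_of_mem (show ω ∈ E.cellCount m ⁻¹' {k + 1} by simp [hN]),
        intraInterference, hN, Finset.mul_sum, expNeg_sum]
      congr 1
      refine Finset.prod_congr rfl fun j _ => ?_
      rw [← ENNReal.ofReal_mul (by positivity)]
      congr 2
      field_simp
    · intro n hn
      rw [Set.indicator_of_notMem, zero_mul]
      simp only [Set.mem_preimage, Set.mem_singleton_iff, hN]
      omega

end RachElements

namespace IsRachModel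

variable {Ω : Type*} [mΩ : MeasurableSpace Ω] {μ : Measure Ω} {p : RachParams} {E : RachElements Ω}

lemma lintegral_mul_of_block [IsProbabilityMeasure μ] (hE : IsRachModel μ p E) (m : ℕ)
    {S T : Set RachSource} (hST : Disjoint S T) {f g : Ω → ℝ≥0∞}
    (hf : Measurable[E.blockSigma m S] f) (hg : Measurable[E.blockSigma m T] g) :
    ∫⁻ ω, f ω * g ω ∂μ = (∫⁻ ω, f ω ∂μ) * ∫⁻ ω, g ω ∂μ :=
  lintegral_mul_eq_lintegral_mul_lintegral_of_independent_measurableSpace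
    (hE.blockSigma_le m S) (hE.blockSigma_le m T) (hE.indep_blockSigma m hST) hf hg

/-- These are the `n` interferers of a cell of size `n + 1`, index `0` being the tagged device. The
received power `ρ` has cancelled against `γ / ρ`. -/
lemma lintegral_prod_fadeIn [IsProbabilityMeasure μ] (hE : IsRachModel μ p E) (m n : ℕ) :
    ∫⁻ ω, ∏ j ∈ Finset.Ico 1 (n + 1), expNeg (ENNReal.ofReal (p.γ * E.fadeIn m j ω)) ∂μ =
      ENNReal.ofReal ((1 / (1 + p.γ)) ^ n) := by
  have hγ := p.γ_pos
  have hg : Measurable fun h : ℝ => expNeg (ENNReal.ofReal (p.γ * h)) :=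
    measurable_expNeg.comp (by fun_prop)
  have hind : iIndepFun (fun j => E.fadeIn m j) μ :=
    (hE.indep m).precomp (g := RachSource.fadeIn) fun _ _ h => by injection h
  have hind' := hind.comp (fun _ h => expNeg (ENNReal.ofReal (p.γ * h))) fun _ => hg
  refine (lintegral_prod_eq_prod_lintegral_of_indepFun _ _ hind' fun j =>
    hg.comp (hE.fadeIn_measurable m j)).trans ?_
  simp only [Function.comp_apply]
  rw [Finset.prod_congr rfl fun j _ => hE.lintegral_fadeIn m j hγ.le, Finset.prod_const,
    Nat.card_Ico, Nat.add_sub_cancel, ENNReal.ofReal_pow (by positivity)]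

lemma lintegral_indicator_mul_prod_fadeIn [IsProbabilityMeasure μ] (hE : IsRachModel μ p E)
    (m n : ℕ) {x : ℝ} (hx : 0 < x) (hxdef : x = E.activeIntensity p μ m / p.lamB) :
    ∫⁻ ω, (E.cellCount m ⁻¹' {n + 1}).indicator 1 ω *
        ∏ j ∈ Finset.Ico 1 (n + 1), expNeg (ENNReal.ofReal (p.γ * E.fadeIn m j ω)) ∂μ =
      ENNReal.ofReal (cellCountPMF x (n + 1) * (1 / (1 + p.γ)) ^ n) := by
  have hg : Measurable fun h : ℝ => expNeg (ENNReal.ofReal (p.γ * h)) :=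
    measurable_expNeg.comp (by fun_prop)
  have hN : Measurable[E.blockSigma m {.count}] (E.cellCount m) :=
    RachElements.measurable_cellCount_block (Set.mem_singleton _)
  have hs : Measurable[E.blockSigma m {.count}]
      ((E.cellCount m ⁻¹' {n + 1}).indicator (1 : Ω → ℝ≥0∞)) :=
    (measurable_of_countable (({n + 1} : Set ℕ).indicator (1 : ℕ → ℝ≥0∞))).comp hN
  have hj : ∀ j, Measurable[E.blockSigma m (Set.range RachSource.fadeIn)] (E.fadeIn m j) :=
    fun j => RachElements.measurable_fadeIn_block ⟨j, rfl⟩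
  have hf : Measurable[E.blockSigma m (Set.range RachSource.fadeIn)] fun ω =>
      ∏ j ∈ Finset.Ico 1 (n + 1), expNeg (ENNReal.ofReal (p.γ * E.fadeIn m j ω)) :=
    Finset.measurable_fun_prod _ fun j _ => hg.comp (hj j)
  have hdis : Disjoint {RachSource.count} (Set.range RachSource.fadeIn) := by simp
  have hNm : MeasurableSet (E.cellCount m ⁻¹' {n + 1}) :=
    hE.cellCount_measurable m (measurableSet_singleton _)
  have hlaw : μ (E.cellCount m ⁻¹' {n + 1}) = ENNReal.ofReal (cellCountPMF x (n + 1)) := by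
    rw [hxdef]
    exact hE.cellCount_law m (n + 1)
  rw [hE.lintegral_mul_of_block m hdis hs hf, lintegral_indicator_one hNm,
    hE.lintegral_prod_fadeIn, ENNReal.ofReal_mul (cellCountPMF_nonneg hx.le _), hlaw]

/-- The generating function at `z = 1 / (1 + γ)`, without its zeroth term, divided by `z` because
the tagged device does not interfere with itself. -/
lemma hasSum_cellCountPMF_succ_mul_pow {x γ : ℝ} (hx : 0 < x) (hγ : 0 < γ) :
    HasSum (fun n : ℕ => cellCountPMF x (n + 1) * (1 / (1 + γ)) ^ n)
      ((1 + γ) * ((1 + x * γ / (cellConst * (1 + γ))) ^ (-cellConst) -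
        (1 + x / cellConst) ^ (-cellConst))) := by
  have hz0 : 0 < 1 / (1 + γ) := by positivity
  have hz1 : 1 / (1 + γ) ≤ 1 := by rw [div_le_one (by positivity)]; linarith
  have hsum := (((hasSum_nat_add_iff' 1).2
    (hasSum_cellCountPMF_mul_pow hx hz0.le hz1)).mul_left (1 + γ))
  rw [Finset.sum_range_one, pow_zero, mul_one, cellCountPMF_zero hx.le,
    show x * (1 - 1 / (1 + γ)) / cellConst = x * γ / (cellConst * (1 + γ)) by
      have := cellConst_pos
      field_simp
      ring] at hsum
  refine hsum.congr_fun fun n => ?_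
  rw [pow_succ]
  field_simp

lemma lintegral_indicator_mul_expNeg_intra [IsProbabilityMeasure μ] (hE : IsRachModel μ p E)
    (m : ℕ) {x : ℝ} (hx : 0 < x) (hxdef : x = E.activeIntensity p μ m / p.lamB) :
    ∫⁻ ω, {ω | 1 ≤ E.cellCount m ω}.indicator 1 ω *
        expNeg (ENNReal.ofReal (p.γ / p.ρ) * E.intraInterference p m ω) ∂μ =
      ENNReal.ofReal ((1 + p.γ) * ((1 + x * p.γ / (cellConst * (1 + p.γ))) ^ (-cellConst) -
        (1 + x / cellConst) ^ (-cellConst))) := by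
  have hγ := p.γ_pos
  have hg : Measurable fun h : ℝ => expNeg (ENNReal.ofReal (p.γ * h)) :=
    measurable_expNeg.comp (by fun_prop)
  have hm : ∀ n : ℕ, Measurable fun ω => (E.cellCount m ⁻¹' {n + 1}).indicator 1 ω *
      ∏ j ∈ Finset.Ico 1 (n + 1), expNeg (ENNReal.ofReal (p.γ * E.fadeIn m j ω)) := fun n =>
    (measurable_one.indicator (hE.cellCount_measurable m (measurableSet_singleton _))).mul
      (Finset.measurable_fun_prod _ fun j _ => hg.comp (hE.fadeIn_measurable m j))
  have hsum := hasSum_cellCountPMF_succ_mul_pow hx hγ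
  calc _ = ∑' n : ℕ, ENNReal.ofReal (cellCountPMF x (n + 1) * (1 / (1 + p.γ)) ^ n) := by
        rw [lintegral_congr (E.indicator_mul_expNeg_intra p m),
          lintegral_tsum fun n => (hm n).aemeasurable]
        exact tsum_congr fun n => hE.lintegral_indicator_mul_prod_fadeIn m n hx hxdef
    _ = _ := by
        rw [← ENNReal.ofReal_tsum_of_nonneg (fun n =>
          mul_nonneg (cellCountPMF_nonneg hx.le _) (by positivity)) hsum.summable, hsum.tsum_eq]

lemma measure_cellCount_pos [IsProbabilityMeasure μ] (hE : IsRachModel μ p E) (m : ℕ) {x : ℝ}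
    (hx : 0 < x) (hxdef : x = E.activeIntensity p μ m / p.lamB) :
    μ {ω | 1 ≤ E.cellCount m ω} = ENNReal.ofReal (1 - (1 + x / cellConst) ^ (-cellConst)) := by
  have h0 : μ {ω | E.cellCount m ω = 0} =
      ENNReal.ofReal ((1 + x / cellConst) ^ (-cellConst)) := by
    rw [← cellCountPMF_zero hx.le, hxdef]
    exact hE.cellCount_law m 0
  have hc : {ω | 1 ≤ E.cellCount m ω} = {ω | E.cellCount m ω = 0}ᶜ := by
    ext ω
    simp [Nat.one_le_iff_ne_zero]
  have hcc := cellConst_pos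
  have hm0 : MeasurableSet {ω | E.cellCount m ω = 0} :=
    hE.cellCount_measurable m (measurableSet_singleton 0)
  rw [hc, prob_compl_eq_one_sub hm0, h0,
    ← ENNReal.ofReal_one, ← ENNReal.ofReal_sub _ (by positivity)]

/-! ### Averaging over the tagged gain, and factorization. -/

/-- The tagged device is detected with probability `exp (-γ J / ρ)`, given the sum `J` of noise and
interference. -/
lemma measure_detection [IsProbabilityMeasure μ] (hE : IsRachModel μ p E) (m : ℕ) :
    μ ({ω | 1 ≤ E.cellCount m ω} ∩ {ω | ENNReal.ofReal p.γ ≤ E.sinr p m ω}) =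
      ∫⁻ ω, {ω | 1 ≤ E.cellCount m ω}.indicator 1 ω * expNeg (ENNReal.ofReal (p.γ / p.ρ) *
        (E.intraInterference p m ω + E.interInterference p m ω + ENNReal.ofReal p.noise)) ∂μ := by
  have hγ := p.γ_pos
  have hρ := p.ρ_pos
  let S : Set RachSource := {.fadeIn 0}
  let J : Ω → ℝ≥0∞ := fun ω =>
    E.intraInterference p m ω + E.interInterference p m ω + ENNReal.ofReal p.noise
  -- Noise plus interference is determined by the sources other than the tagged gain, hence
  -- independent of it.
  have hJ : Measurable[E.blockSigma m Sᶜ] J := by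
    refine Measurable.add (Measurable.add ?_ ?_) measurable_const
    · refine @RachElements.measurable_intraInterference Ω (E.blockSigma m Sᶜ) E m p
        (RachElements.measurable_cellCount_block (by simp [S])) fun j hj =>
          RachElements.measurable_fadeIn_block ?_
      have : j ≠ 0 := by omega
      simp [S, this]
    · exact @RachElements.measurable_interInterference Ω (E.blockSigma m Sᶜ) E m p
        (RachElements.measurable_u_block (by simp [S])) fun i =>
          RachElements.measurable_mark_block (by simp [S, RachElements.markSources])
  have hN : Measurable[E.blockSigma m Sᶜ] (E.cellCount m) :=
    RachElements.measurable_cellCount_block (by simp [S])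
  have hX : Measurable[E.blockSigma m Sᶜ] fun ω => (E.cellCount m ω, J ω) := hN.prodMk hJ
  have hind := hE.indepFun_of_block m (S := Sᶜ) (T := S) disjoint_compl_left hX
    (RachElements.measurable_fadeIn_block (i := 0) (Set.mem_singleton _))
  let A : Set ((ℕ × ℝ≥0∞) × ℝ) :=
    {z | 1 ≤ z.1.1 ∧ ENNReal.ofReal (p.γ / p.ρ) * z.1.2 ≤ ENNReal.ofReal z.2}
  have hA : MeasurableSet A := by
    have h1 : MeasurableSet {z : (ℕ × ℝ≥0∞) × ℝ | 1 ≤ z.1.1} :=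
      measurableSet_le (by fun_prop) (by fun_prop)
    have h2 : MeasurableSet {z : (ℕ × ℝ≥0∞) × ℝ |
        ENNReal.ofReal (p.γ / p.ρ) * z.1.2 ≤ ENNReal.ofReal z.2} :=
      measurableSet_le (by fun_prop) (by fun_prop)
    exact h1.inter h2
  have hXm := hX.mono (hE.blockSigma_le m Sᶜ) le_rfl
  have hfub := lintegral_comp_indepFun hXm (hE.fadeIn_measurable m 0) hind
    (F := fun x y => A.indicator 1 (x, y)) (measurable_one.indicator hA)
  -- Positivity of the gain rules out the quotient `0 / 0` in the SINR, where clearing the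
  -- denominator would fail.
  have hpos : ∀ᵐ ω ∂μ, 0 < E.fadeIn m 0 ω := by
    have : ∀ᵐ h ∂(μ.map (E.fadeIn m 0)), 0 < h := by
      rw [hE.fadeIn_law, expMeasure_one_eq]
      exact (withDensity_absolutelyContinuous _ _).ae_le
        (self_mem_ae_restrict measurableSet_Ioi)
    exact ae_of_ae_map (hE.fadeIn_measurable m 0).aemeasurable this
  have hmA : MeasurableSet {ω | ((E.cellCount m ω, J ω), E.fadeIn m 0 ω) ∈ A} :=
    (hXm.prodMk (hE.fadeIn_measurable m 0)) hA
  calc _ = μ {ω | ((E.cellCount m ω, J ω), E.fadeIn m 0 ω) ∈ A} := by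
        refine measure_congr ?_
        filter_upwards [hpos] with ω hω
        refine propext (and_congr_right fun _ => ?_)
        change ENNReal.ofReal p.γ ≤ ENNReal.ofReal (p.ρ * E.fadeIn m 0 ω) / J ω ↔
          ENNReal.ofReal (p.γ / p.ρ) * J ω ≤ ENNReal.ofReal (E.fadeIn m 0 ω)
        have hs : ENNReal.ofReal (p.ρ * E.fadeIn m 0 ω) ≠ 0 := by
          rw [ne_eq, ENNReal.ofReal_eq_zero, not_le]
          positivity
        have hρ0 : ENNReal.ofReal p.ρ ≠ 0 := by simpa using hρ
        rw [ENNReal.le_div_iff_mul_le (Or.inr hs) (Or.inr ENNReal.ofReal_ne_top),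
          ENNReal.ofReal_mul hρ.le, show p.γ = p.ρ * (p.γ / p.ρ) by field_simp,
          ENNReal.ofReal_mul hρ.le, mul_assoc, show p.ρ * (p.γ / p.ρ) / p.ρ = p.γ / p.ρ by
            field_simp]
        exact ENNReal.mul_le_mul_iff_right hρ0 ENNReal.ofReal_ne_top
    _ = ∫⁻ ω, A.indicator 1 ((E.cellCount m ω, J ω), E.fadeIn m 0 ω) ∂μ := by
        rw [← lintegral_indicator_one hmA]
        rfl
    _ = _ := by
        refine hfub.trans (lintegral_congr fun ω => ?_)
        by_cases h1 : 1 ≤ E.cellCount m ω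
        · have hB : MeasurableSet {h : ℝ | ENNReal.ofReal (p.γ / p.ρ) * J ω ≤ ENNReal.ofReal h} :=
            measurableSet_le measurable_const ENNReal.measurable_ofReal
          rw [Set.indicator_of_mem (by exact h1), Pi.one_apply, one_mul, ← expMeasure_one_tail,
            ← hE.fadeIn_law m 0, ← lintegral_indicator_one hB,
            lintegral_map (measurable_one.indicator hB) (hE.fadeIn_measurable m 0)]
          refine lintegral_congr fun ω' => ?_
          have : ((E.cellCount m ω, J ω), E.fadeIn m 0 ω') ∈ A ↔ E.fadeIn m 0 ω' ∈
              {h : ℝ | ENNReal.ofReal (p.γ / p.ρ) * J ω ≤ ENNReal.ofReal h} :=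
            ⟨fun h => h.2, fun h => ⟨h1, h⟩⟩
          by_cases h2 : E.fadeIn m 0 ω' ∈
              {h : ℝ | ENNReal.ofReal (p.γ / p.ρ) * J ω ≤ ENNReal.ofReal h}
          · rw [Set.indicator_of_mem h2, Set.indicator_of_mem (this.2 h2)]; rfl
          · rw [Set.indicator_of_notMem h2, Set.indicator_of_notMem (mt this.1 h2)]
        · have : ∀ ω', ((E.cellCount m ω, J ω), E.fadeIn m 0 ω') ∉ A := fun ω' h => h1 h.1
          rw [Set.indicator_of_notMem (by exact h1), zero_mul]
          simp [this]

/-- Intra-cell interference, inter-cell interference and noise contribute independent factors. -/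
lemma measure_detection_eq_mul [IsProbabilityMeasure μ] (hE : IsRachModel μ p E) (m : ℕ) :
    μ ({ω | 1 ≤ E.cellCount m ω} ∩ {ω | ENNReal.ofReal p.γ ≤ E.sinr p m ω}) =
      (∫⁻ ω, {ω | 1 ≤ E.cellCount m ω}.indicator 1 ω *
        expNeg (ENNReal.ofReal (p.γ / p.ρ) * E.intraInterference p m ω) ∂μ) *
      (∫⁻ ω, expNeg (ENNReal.ofReal (p.γ / p.ρ) * E.interInterference p m ω) ∂μ) *
        ENNReal.ofReal (Real.exp (-(p.γ * p.noise / p.ρ))) := by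
  have hγ := p.γ_pos
  have hρ := p.ρ_pos
  have hnoise := p.noise_nonneg
  let S : Set RachSource := insert .count (Set.range RachSource.fadeIn)
  have hN : Measurable[E.blockSigma m S] (E.cellCount m) :=
    RachElements.measurable_cellCount_block (by simp [S])
  have hi : Measurable[E.blockSigma m S]
      ({ω | 1 ≤ E.cellCount m ω}.indicator (1 : Ω → ℝ≥0∞)) :=
    (measurable_of_countable ({n : ℕ | 1 ≤ n}.indicator (1 : ℕ → ℝ≥0∞))).comp hN
  have h1 : Measurable[E.blockSigma m S] fun ω => {ω | 1 ≤ E.cellCount m ω}.indicator 1 ω *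
      expNeg (ENNReal.ofReal (p.γ / p.ρ) * E.intraInterference p m ω) :=
    hi.mul (measurable_expNeg.comp (Measurable.const_mul
      (@RachElements.measurable_intraInterference Ω (E.blockSigma m S) E m p hN fun j _ =>
        RachElements.measurable_fadeIn_block (by simp [S])) _))
  have h2 : Measurable[E.blockSigma m Sᶜ] fun ω =>
      expNeg (ENNReal.ofReal (p.γ / p.ρ) * E.interInterference p m ω) :=
    measurable_expNeg.comp (Measurable.const_mul
      (@RachElements.measurable_interInterference Ω (E.blockSigma m Sᶜ) E m p
        (RachElements.measurable_u_block (by simp [S])) fun i =>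
          RachElements.measurable_mark_block (by
            rintro s (rfl | rfl | rfl | rfl) <;> simp [S])) _)
  have h12 : Measurable fun ω => {ω | 1 ≤ E.cellCount m ω}.indicator 1 ω *
      expNeg (ENNReal.ofReal (p.γ / p.ρ) * E.intraInterference p m ω) *
        expNeg (ENNReal.ofReal (p.γ / p.ρ) * E.interInterference p m ω) :=
    (h1.mono (hE.blockSigma_le m S) le_rfl).mul (h2.mono (hE.blockSigma_le m Sᶜ) le_rfl)
  rw [hE.measure_detection, ← hE.lintegral_mul_of_block m disjoint_compl_right h1 h2,
    ← lintegral_mul_const _ h12]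
  refine lintegral_congr fun ω => ?_
  rw [mul_add, mul_add, expNeg_add, expNeg_add, ← ENNReal.ofReal_mul (by positivity),
    expNeg_ofReal (by positivity), show p.γ / p.ρ * p.noise = p.γ * p.noise / p.ρ by ring]
  ring

end IsRachModel

/-! ### Conditioning on a non-empty cell and assembling the factors. -/

theorem lemma3 {Ω : Type*} [MeasurableSpace Ω] (μ : Measure Ω) [IsProbabilityMeasure μ]
    (p : RachParams) (E : RachElements Ω) (hE : IsRachModel μ p E) (m : ℕ)
    (hT : 0 < E.nonEmptyProb μ m) (hR : 0 < E.nonRestrictProb μ m) :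
    IntegrableOn (fun y : ℝ => y / (1 + y ^ p.α)) (Set.Ioi (p.γ ^ (-1 / p.α))) ∧
    E.detectionProb p μ m =
      Real.exp (-(p.γ * p.noise / p.ρ) -
          2 * p.γ ^ (2 / p.α) *
            (E.nonEmptyProb μ m * E.nonRestrictProb μ m * p.lamDp / p.lamB) *
            ∫ y in Set.Ioi (p.γ ^ (-1 / p.α)), y / (1 + y ^ p.α)) *
        ((1 + E.nonEmptyProb μ m * E.nonRestrictProb μ m * p.lamDp * p.γ /
              (cellConst * p.lamB * (1 + p.γ))) ^ (-cellConst) -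
          (cellConst * p.lamB /
              (cellConst * p.lamB + E.nonEmptyProb μ m * E.nonRestrictProb μ m * p.lamDp)) ^
            cellConst) *
        ((1 + p.γ) *
            (1 + E.nonEmptyProb μ m * E.nonRestrictProb μ m * p.lamDp / (cellConst * p.lamB)) ^
              cellConst /
          ((1 + E.nonEmptyProb μ m * E.nonRestrictProb μ m * p.lamDp / (cellConst * p.lamB)) ^
              cellConst - 1)) := by
  have hγ := p.γ_pos
  have hB := p.lamB_pos
  have hc := cellConst_pos
  have hDp : 0 < p.lamDp := div_pos p.lamD_pos (Nat.cast_pos.2 p.ξ_pos)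
  refine ⟨integrableOn_div_one_add_rpow p.two_lt_α (Real.rpow_pos_of_pos hγ _), ?_⟩
  set a := E.nonEmptyProb μ m * E.nonRestrictProb μ m * p.lamDp with ha
  have ha0 : 0 < a := by positivity
  have hx : 0 < a / p.lamB := by positivity
  have hxdef : a / p.lamB = E.activeIntensity p μ m / p.lamB := rfl
  set I := ∫ y in Set.Ioi (p.γ ^ (-1 / p.α)), y / (1 + y ^ p.α) with hI
  have hNm : MeasurableSet {ω | 1 ≤ E.cellCount m ω} :=
    hE.cellCount_measurable m (measurableSet_Ici (a := 1))
  set b := 1 + a / (cellConst * p.lamB) with hb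
  have hb1 : 1 < b := by
    have : 0 < a / (cellConst * p.lamB) := by positivity
    linarith
  have hb0 : 0 < b := zero_lt_one.trans hb1
  have eb : 1 + a / p.lamB / cellConst = b := by
    rw [hb, div_div, mul_comm p.lamB]
  have ebinv : cellConst * p.lamB / (cellConst * p.lamB + a) = b⁻¹ := by
    rw [hb]; field_simp
  have ed : 1 + a / p.lamB * p.γ / (cellConst * (1 + p.γ)) =
      1 + a * p.γ / (cellConst * p.lamB * (1 + p.γ)) := by
    field_simp
  set d := 1 + a * p.γ / (cellConst * p.lamB * (1 + p.γ)) with hd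
  have hd1 : 1 ≤ d := by
    have : 0 ≤ a * p.γ / (cellConst * p.lamB * (1 + p.γ)) := by positivity
    linarith
  -- Since `γ / (1 + γ) ≤ 1`. This makes the bracket nonnegative, so that `ENNReal.ofReal` does not
  -- truncate it.
  have hdb : d ≤ b := by
    rw [hd, hb]
    have : a * p.γ / (cellConst * p.lamB * (1 + p.γ)) ≤ a / (cellConst * p.lamB) := by
      rw [div_le_div_iff₀ (by positivity) (by positivity)]
      have : 0 ≤ a * (cellConst * p.lamB) := by positivity
      nlinarith
    linarith
  have hdiff : 0 ≤ d ^ (-cellConst) - b ^ (-cellConst) :=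
    sub_nonneg.2 (Real.rpow_le_rpow_of_nonpos (by linarith) hdb (by linarith))
  have hbc : 1 < b ^ cellConst := Real.one_lt_rpow hb1 hc
  have hinter := hE.lintegral_expNeg_inter m
  rw [← ha, ← hI] at hinter
  rw [RachElements.detectionProb, Measure.real, cond_apply hNm, hE.measure_detection_eq_mul m,
    hE.lintegral_indicator_mul_expNeg_intra m hx hxdef, hinter,
    hE.measure_cellCount_pos m hx hxdef, eb, ed, ebinv, Real.inv_rpow hb0.le,
    Real.rpow_neg hb0.le]
  rw [Real.rpow_neg hb0.le] at hdiff
  have hsub : 0 ≤ 1 - (b ^ cellConst)⁻¹ := sub_nonneg.2 (inv_le_one_of_one_le₀ hbc.le)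
  rw [ENNReal.toReal_mul, ENNReal.toReal_mul, ENNReal.toReal_mul, ENNReal.toReal_inv,
    ENNReal.toReal_ofReal hsub, ENNReal.toReal_ofReal (by positivity),
    ENNReal.toReal_ofReal (Real.exp_nonneg _), ENNReal.toReal_ofReal (Real.exp_nonneg _),
    sub_eq_add_neg (-(p.γ * p.noise / p.ρ)), Real.exp_add]
  have h1 : b ^ cellConst - 1 ≠ 0 := by linarith
  -- Dividing by the probability of a non-empty cell produces the last factor `b ^ c / (b ^ c - 1)`
  -- of the claim.
  have h2 : 1 - (b ^ cellConst)⁻¹ = (b ^ cellConst - 1) / b ^ cellConst := by field_simp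
  rw [h2]
  field_simp
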